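/- **Setting.** Let $\epsilon>0$ and let $\psi\in C^2(\mathbb R^2)$ satisfy, for all $(x,\theta)\in\mathbb R^2$, $$\psi_{x\theta}(x,\theta)\ge 0,\qquad \psi(-x,-\theta)=\psi(x,\theta),\qquad \psi_x(x,\theta)=0\ \text{ whenever } |x|\ge\epsilon .$$ For $N$ particles on the line let $(\boldsymbol x,\boldsymbol p)\in\mathbb R^{2N}$ be canonical coordinates, $\{x_i,p_j\}=\delta_{ij}$. For $\lambda\ge 0$ consider the relation $\omega^\lambda(\boldsymbol y,\boldsymbol\theta)=(\boldsymbol x,\boldsymbol p)$ given by $$y_i=x_i+\lambda\sum_{j\ne i}\psi_\theta(x_i-x_j,\theta_i-\theta_j),\qquad p_i=\theta_i+\lambda\sum_{j\ne i}\psi_x(x_i-x_j,\theta_i-\theta_j),$$ and put $$H_\lambda(\boldsymbol x,\boldsymbol p)=H_{\lambda\psi}(\boldsymbol x,\boldsymbol p)=\sum_{i=1}^N\tfrac12\,\theta_i^\lambda(\boldsymbol x,\boldsymbol p)^2,$$ where $\boldsymbol\theta^\lambda(\boldsymbol x,\boldsymbol p)$ is the $\boldsymbol\theta$-component of the solution $(\boldsymbol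 y,\boldsymbol\theta)$ of $\omega^\lambda(\boldsymbol y,\boldsymbol\theta)=(\boldsymbol x,\boldsymbol p)$. Write $\dot x_i^\lambda=\{x_i,H_\lambda\}$. **Definitions.** A *many-particle system* is a sequence of $C^1$ Hamiltonians $H$ on $\mathbb R^{2N}$, $N\ge1$, invariant under relabelling of the particles, whose trajectories exist globally and are unique. For $\boldsymbol x\in\mathbb R^N$ the *clusters* are the classes of the equivalence relation on $\{1,\dots,N\}$ generated by $|x_i-x_j|\le\epsilon$; for a cluster $I$, $(\boldsymbol x_I,\boldsymbol p_I)$ are the coordinates of its particles, in increasing order of labels. Functions on phase space are *functionally independent* if their differentials are linearly independent on a dense set. * *Liouville integrable with finite-range interaction, range $\epsilon$:* for each $N$, $H$ is a nontrivial linear combination of $N$ differentiable, functionally independent functions in involution; and there are $V_a^{(n)}\in C^1(\mathbb R^{2n})$, $a,n\ge1$, independent of $N$, with $V_a^{(1)}=0$, such that for each $N$ the functions $Q_a=\sum_i p_i^a+\sum_{I\text{ cluster}}V_a^{(|I|)}(\boldsymbol x_I,\boldsymbol p_I)$ are $C^1$ and in involution, $Q_1,\dots,Q_N$ are functionally independent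 (as are $\sum_ip_i^a$, $a=1,\dots,N$), and $H=\frac12Q_2$. * *Elastic, factorised scattering with tracer dynamics and two-body shift $\varphi\in C^1(\mathbb R^2)$:* for each $N$ there is a dense set $\mathcal S'\subset\mathbb R^{2N}$, invariant under time evolution, such that every trajectory starting in $\mathcal S'$ satisfies $p_i(t)=\theta_i+o(1)$ and $x_i(t)=\theta_it+x_i^\pm+o(1)$ as $t\to\pm\infty$, with $x_i^+-x_i^-=\sum_{j\ne i}\operatorname{sgn}(\theta_j-\theta_i)\,\varphi(\theta_i,\theta_j)$, and the map $(\boldsymbol x(0),\boldsymbol p(0))\mapsto(\boldsymbol x^-,\boldsymbol\theta)$ is a bijection from $\mathcal S'$ onto the set of those $(\boldsymbol y,\boldsymbol\theta)\in\mathbb R^{2N}$ with pairwise distinct $\theta_i$. * *Finite-range tracer dynamics, range $\epsilon$:* in addition, there are $\vartheta^{(n,r)}\in C^1(\mathbb R^{2n})$, $1\le r\le n$, independent of $N$, such that the asymptotic momentum (extended to $\mathbb R^{2N}$) of the $r$-th particle of each cluster $I$ is $\vartheta^{(|I|,r)}(\boldsymbol x_I,\boldsymbol p_I)$. * A family $(H_\lambda)_{\lambda\in[0,1]}$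 of many-particle systems is a *generalised $T\bar T$ flow with deformation function $w\in C^1(\mathbb R^2)$* if $H_\lambda(\boldsymbol x,\boldsymbol p)$ is differentiable in $\lambda\in[0,1]$ at every phase-space point, and each $H_\lambda$ is, for some range depending on $\lambda$, Liouville integrable with finite-range interaction and a finite-range tracer dynamics with elastic, factorised scattering (for some shift and some dense sets $\mathcal S'_\lambda$), such that for all $\lambda\in[0,1]$, all $N\ge1$ and all $(\boldsymbol x,\boldsymbol p)\in\mathcal S_\lambda'$ $$\frac{\partial H_\lambda(\boldsymbol x,\boldsymbol p)}{\partial\lambda}=-\sum_{i,j}\big(\dot x_i^\lambda-\dot x_j^\lambda\big)\,w\big(x_i-x_j,\theta_i^\lambda-\theta_j^\lambda\big),\tag{$*$}$$ where $\theta^\lambda_i$ are the asymptotic momenta. Then $H_1$ is called a *generalised $T\bar T$-deformation* of $H_0$. **Theorem (generalised $T\bar T$-deformation).** For every $N$: 1. For every $\lambda\ge0$, $\omega^\lambda$ is a well-defined bijection of $\mathbb R^{2N}$; thus $\boldsymbol\theta^\lambda$ and $H_\lambda$ are well defined. 2. For every $(\boldsymbol x,\boldsymbol p)\in\mathbb R^{2N}$,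 the function $\lambda\mapsto H_\lambda(\boldsymbol x,\boldsymbol p)$ is differentiable on $[0,\infty)$ (one-sidedly at $0$) and satisfies $(*)$ with $w(x,\theta)=\frac12\psi_x(x,\theta)$ and $\boldsymbol\theta^\lambda=\boldsymbol\theta^\lambda(\boldsymbol x,\boldsymbol p)$ defined through $\omega^\lambda$. 3. For every $\lambda\ge0$ and almost every $(\boldsymbol x,\boldsymbol p)$, the $\theta_i^\lambda(\boldsymbol x,\boldsymbol p)$ are the limits of $p_i(t)$ as $t\to\pm\infty$ along the trajectory of $H_\lambda$ starting at $(\boldsymbol x,\boldsymbol p)$. Moreover, $(H_\lambda)_{\lambda\in[0,1]}$ is a generalised $T\bar T$ flow with deformation function $w=\frac12\psi_x$. Hence $H_\psi=H_1$ is a generalised $T\bar T$-deformation of the system of free particles $H_0=\sum_ip_i^2/2$. -/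

import Mathlib

open Set Filter Topology MeasureTheory

/-- Canonical phase space `ℝ^{2N}`: a point is a pair (positions, momenta). -/
abbrev Phase (N : ℕ) : Type := (Fin N → ℝ) × (Fin N → ℝ)

/-- A many-particle system is a sequence of Hamiltonians, one for each particle number. -/
abbrev ManyBody : Type := (N : ℕ) → Phase N → ℝ

/-- The canonical Poisson bracket, normalised by `{x_i, p_j} = δ_ij`. -/
noncomputable def poisson {N : ℕ} (F G : Phase N → ℝ) (z : Phase N) : ℝ :=
  ∑ i, (fderiv ℝ F z (Pi.single i 1, 0) * fderiv ℝ G z (0, Pi.single i 1)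
    - fderiv ℝ F z (0, Pi.single i 1) * fderiv ℝ G z (Pi.single i 1, 0))

/-- The velocity `ẋ_i = {x_i, H}` as a function on phase space. -/
noncomputable def velocity {N : ℕ} (H : Phase N → ℝ) (z : Phase N) (i : Fin N) : ℝ :=
  poisson (fun u => u.1 i) H z

/-- The force `ṗ_i = {p_i, H}` as a function on phase space. -/
noncomputable def force {N : ℕ} (H : Phase N → ℝ) (z : Phase N) (i : Fin N) : ℝ :=
  poisson (fun u => u.2 i) H z

/-- Global solutions of Hamilton's equations. -/
def IsTrajectory {N : ℕ} (H : Phase N → ℝ) (γ : ℝ → Phase N) : Prop :=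
  ∀ t, HasDerivAt γ (velocity H (γ t), force H (γ t)) t

/-- `H` is `C¹`, invariant under relabelling of the particles, and its trajectories exist for all
times and are fully determined by the initial condition, for every particle number `N ≥ 1`. -/
structure IsManyBodySystem (H : ManyBody) : Prop where
  contDiff : ∀ N, 1 ≤ N → ContDiff ℝ 1 (H N)
  relabel : ∀ N, 1 ≤ N → ∀ (σ : Equiv.Perm (Fin N)) (z : Phase N),
    H N (z.1 ∘ σ, z.2 ∘ σ) = H N z
  dynamics : ∀ N, 1 ≤ N → ∀ z : Phase N, ∃! γ : ℝ → Phase N, IsTrajectory (H N) γ ∧ γ 0 = z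

/-! ### Liouville integrability and finite-range interactions -/

/-- Functional independence: the differentials are linearly independent on a dense set. -/
def FunctionallyIndependent {N n : ℕ} (Q : Fin n → Phase N → ℝ) : Prop :=
  Dense {z : Phase N | LinearIndependent ℝ (fun a => fderiv ℝ (Q a) z)}

/-- Liouville integrability of an `N`-particle Hamiltonian. -/
def IsLiouvilleIntegrable {N : ℕ} (H : Phase N → ℝ) : Prop :=
  ∃ (Q : Fin N → Phase N → ℝ) (c : Fin N → ℝ),
    (∀ a, Differentiable ℝ (Q a)) ∧ FunctionallyIndependent Q ∧
    (∀ a b z, poisson (Q a) (Q b) z = 0) ∧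
    c ≠ 0 ∧ ∀ z, H z = ∑ a, c a * Q a z

/-- `i` and `j` are linked by a chain of particles, each at distance at most `ε` from the next. -/
def SameCluster {N : ℕ} (ε : ℝ) (x : Fin N → ℝ) : Fin N → Fin N → Prop :=
  Relation.ReflTransGen (fun i j => |x i - x j| ≤ ε)

open Classical in
/-- The cluster of the particle `i`. -/
noncomputable def cluster {N : ℕ} (ε : ℝ) (x : Fin N → ℝ) (i : Fin N) : Finset (Fin N) :=
  Finset.univ.filter (fun j => SameCluster ε x i j)

/-- The partition of the particles into clusters: the finest partition whose distinct classes are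
at distance larger than `ε` from each other. -/
noncomputable def clusters {N : ℕ} (ε : ℝ) (x : Fin N → ℝ) : Finset (Finset (Fin N)) :=
  Finset.univ.image (cluster ε x)

/-- The coordinates `(x_I, p_I)` of the particles in `I`, in increasing order of the labels. -/
def restrictTo {N : ℕ} (z : Phase N) (I : Finset (Fin N)) : Phase I.card :=
  (fun r => z.1 (I.orderEmbOfFin rfl r), fun r => z.2 (I.orderEmbOfFin rfl r))

/-- The `N`-particle quantity `∑ i, E (p_i) + ∑_I V^{(|I|)} (x_I, p_I)`, `I` ranging over the
clusters: a kinetic part with dispersion relation `E` plus a quasi-potential of range `ε`. -/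
noncomputable def clusterCharge (ε : ℝ) (E : ℝ → ℝ) (V : (n : ℕ) → Phase n → ℝ) (N : ℕ)
    (z : Phase N) : ℝ :=
  ∑ i, E (z.2 i) + ∑ I ∈ clusters ε z.1, V I.card (restrictTo z I)

/-- Liouville integrability with interaction of finite range `ε`, for charges
`Q_1, Q_2, …` with dispersion relations `E_1, E_2, …` (the code counts them from `0`) and
`H = ∑ a, c_a Q_a` with finitely many nonzero `c_a`. The `n`-particle quasi-potentials `V a n` do
not depend on `N`. For each `N`, the first `N` charges are functionally independent. -/
def IsFiniteRangeLiouville (ε : ℝ) (E : ℕ → ℝ → ℝ) (c : ℕ →₀ ℝ) (H : ManyBody) : Prop :=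
  c ≠ 0 ∧ (∀ a, ContDiff ℝ 1 (E a)) ∧
  (∀ N, 1 ≤ N → IsLiouvilleIntegrable (H N)) ∧
  (∀ N, 1 ≤ N →
    FunctionallyIndependent (fun (a : Fin N) (z : Phase N) => ∑ i, E a (z.2 i))) ∧
  ∃ V : ℕ → (n : ℕ) → Phase n → ℝ,
    (∀ a n, ContDiff ℝ 1 (V a n)) ∧ (∀ a z, V a 1 z = 0) ∧
    ∀ N, 1 ≤ N →
      (∀ a, ContDiff ℝ 1 (clusterCharge ε (E a) (V a) N)) ∧
      FunctionallyIndependent (fun (a : Fin N) => clusterCharge ε (E a) (V a) N) ∧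
      (∀ a b z, poisson (clusterCharge ε (E a) (V a) N) (clusterCharge ε (E b) (V b) N) z = 0) ∧
      ∀ z, H N z = ∑ a ∈ c.support, c a * clusterCharge ε (E a) (V a) N z

/-! ### Elastic, factorised scattering and tracer dynamics -/

/-- Pairs `(y, θ)` with pairwise distinct `θ_i`. -/
def distinctMomenta (N : ℕ) : Set (Phase N) :=
  {q | ∀ i j, i ≠ j → q.2 i ≠ q.2 j}

/-- Elastic, factorised scattering of the `N`-particle Hamiltonian `H` on the dense invariant set
`S`, with two-body shift `φ`: asymptotic momenta `θ`, impact parameters `xm` (incoming) and `xp`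
(outgoing), and permutation `σ`, all as functions of the initial condition. -/
structure IsElasticFactorised {N : ℕ} (H : Phase N → ℝ) (φ : ℝ → ℝ → ℝ) (S : Set (Phase N))
    (θ xm xp : Phase N → Fin N → ℝ) (σ : Phase N → Equiv.Perm (Fin N)) : Prop where
  dense : Dense S
  invariant : ∀ γ, IsTrajectory H γ → γ 0 ∈ S → ∀ t, γ t ∈ S
  in_p : ∀ γ, IsTrajectory H γ → γ 0 ∈ S → ∀ i,
    Tendsto (fun t => (γ t).2 i) atBot (𝓝 (θ (γ 0) i))
  in_x : ∀ γ, IsTrajectory H γ → γ 0 ∈ S → ∀ i,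
    Tendsto (fun t => (γ t).1 i - θ (γ 0) i * t) atBot (𝓝 (xm (γ 0) i))
  out_p : ∀ γ, IsTrajectory H γ → γ 0 ∈ S → ∀ i,
    Tendsto (fun t => (γ t).2 i) atTop (𝓝 (θ (γ 0) (σ (γ 0) i)))
  out_x : ∀ γ, IsTrajectory H γ → γ 0 ∈ S → ∀ i,
    Tendsto (fun t => (γ t).1 i - θ (γ 0) (σ (γ 0) i) * t) atTop (𝓝 (xp (γ 0) (σ (γ 0) i)))
  shift : ∀ z ∈ S, ∀ i, xp z i - xm z i =
    ∑ j ∈ Finset.univ.erase i, Real.sign (θ z j - θ z i) * φ (θ z i) (θ z j)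
  bij : BijOn (fun z => (xm z, θ z)) S (distinctMomenta N)

/-- `H` satisfies the elastic, factorised scattering condition with two-body shift `φ`, and is a
finite-range tracer dynamics with range `ε`: the scattering permutation is the identity, and
`θ_{I(r)}(x, p) = ϑ^{(|I|, r)}(x_I, p_I)` for every cluster `I`, with `C¹` functions `ϑ^{(n, r)}`
independent of `N`. Here `S N` is the dense set of initial conditions and `θ N` gives the
asymptotic momenta of the `N`-particle system (on `S N`, and its extension to `ℝ^{2N}`). -/
def IsFiniteRangeTracer (ε : ℝ) (φ : ℝ → ℝ → ℝ) (H : ManyBody) (S : (N : ℕ) → Set (Phase N))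
    (θ : (N : ℕ) → Phase N → Fin N → ℝ) : Prop :=
  ContDiff ℝ 1 (Function.uncurry φ) ∧
  (∀ N, 1 ≤ N → ∃ (xm xp : Phase N → Fin N → ℝ) (σ : Phase N → Equiv.Perm (Fin N)),
    IsElasticFactorised (H N) φ (S N) (θ N) xm xp σ ∧ ∀ z ∈ S N, σ z = 1) ∧
  ∃ ϑ : (n : ℕ) → Fin n → Phase n → ℝ,
    (∀ n r, ContDiff ℝ 1 (ϑ n r)) ∧
    ∀ N, 1 ≤ N → ∀ z : Phase N, ∀ I ∈ clusters ε z.1, ∀ r : Fin I.card,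
      θ N z (I.orderEmbOfFin rfl r) = ϑ I.card r (restrictTo z I)

/-- `θ` are the momenta at `t → ± ∞` of the trajectory of `H` that starts at `z`. -/
def IsAsymptoticMomenta {N : ℕ} (H : Phase N → ℝ) (z : Phase N) (θ : Fin N → ℝ) : Prop :=
  (∃ γ, IsTrajectory H γ ∧ γ 0 = z) ∧
  ∀ γ, IsTrajectory H γ → γ 0 = z → ∀ i,
    Tendsto (fun t => (γ t).2 i) atBot (𝓝 (θ i)) ∧ Tendsto (fun t => (γ t).2 i) atTop (𝓝 (θ i))

/-! ### Generalised `TT̄`-deformations -/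

/-- `-∑_{ij} (ẋ_i - ẋ_j) w(x_i - x_j, θ_i - θ_j)`, velocities being taken with respect to `H`. -/
noncomputable def ttbarSource {N : ℕ} (w : ℝ → ℝ → ℝ) (H : Phase N → ℝ) (z : Phase N)
    (θ : Fin N → ℝ) : ℝ :=
  -∑ i, ∑ j, (velocity H z i - velocity H z j) * w (z.1 i - z.1 j) (θ i - θ j)

/-- The family `H s`, `s ∈ [0,1]`, is a generalised `TT̄` flow with deformation function `w`. The
charges are `Q_a = ∑ i, p_i ^ a + V_a`, `a = 1, 2, …`, and the Hamiltonian is `Q_2 / 2`. -/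
structure IsGenTTbarFlow (w : ℝ → ℝ → ℝ) (H : ℝ → ManyBody) : Prop where
  contDiff : ContDiff ℝ 1 (Function.uncurry w)
  system : ∀ s ∈ Icc (0 : ℝ) 1, IsManyBodySystem (H s)
  differentiable : ∀ s ∈ Icc (0 : ℝ) 1, ∀ N, 1 ≤ N → ∀ z : Phase N,
    DifferentiableWithinAt ℝ (fun u => H u N z) (Icc 0 1) s
  flow : ∀ s ∈ Icc (0 : ℝ) 1, ∃ ε > 0,
    IsFiniteRangeLiouville ε (fun a p => p ^ (a + 1)) (Finsupp.single 1 (1 / 2)) (H s) ∧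
    ∃ (φ : ℝ → ℝ → ℝ) (S : (N : ℕ) → Set (Phase N)) (θ : (N : ℕ) → Phase N → Fin N → ℝ),
      IsFiniteRangeTracer ε φ (H s) S θ ∧
      ∀ N, 1 ≤ N → ∀ z ∈ S N,
        HasDerivWithinAt (fun u => H u N z) (ttbarSource w (H s N) z (θ N z)) (Icc 0 1) s

/-- `H₁` is a generalised `TT̄`-deformation of `H₀`. -/
def IsGenTTbarDeformation (H₀ H₁ : ManyBody) : Prop :=
  ∃ (w : ℝ → ℝ → ℝ) (H : ℝ → ManyBody), H 0 = H₀ ∧ H 1 = H₁ ∧ IsGenTTbarFlow w H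

/-- The free-particle Hamiltonian. -/
noncomputable def freeHamiltonian : ManyBody := fun _ z => ∑ i, z.2 i ^ 2 / 2

/-! ### Semiclassical Bethe systems -/

/-- `ψ_x`. -/
noncomputable def dX (ψ : ℝ → ℝ → ℝ) (x θ : ℝ) : ℝ := deriv (fun u => ψ u θ) x

/-- `ψ_θ`. -/
noncomputable def dTheta (ψ : ℝ → ℝ → ℝ) (x θ : ℝ) : ℝ := deriv (fun t => ψ x t) θ

/-- The relation `ω(y, θ) = (x, p)`, with `q = (y, θ)` and `z = (x, p)`. -/
def BetheRel {N : ℕ} (ψ : ℝ → ℝ → ℝ) (q z : Phase N) : Prop :=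
  (∀ i, q.1 i = z.1 i +
    ∑ j ∈ Finset.univ.erase i, dTheta ψ (z.1 i - z.1 j) (q.2 i - q.2 j)) ∧
  (∀ i, z.2 i = q.2 i +
    ∑ j ∈ Finset.univ.erase i, dX ψ (z.1 i - z.1 j) (q.2 i - q.2 j))

/-- `θ(x, p)`: the second component of the `(y, θ)` with `ω(y, θ) = (x, p)`. -/
noncomputable def betheMomenta {N : ℕ} (ψ : ℝ → ℝ → ℝ) (z : Phase N) : Fin N → ℝ :=
  (Classical.epsilon (fun q : Phase N => BetheRel ψ q z)).2

/-- The Hamiltonian `H_ψ(x, p) = ∑ i, θ_i(x, p)² / 2`. -/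
noncomputable def betheHamiltonian (ψ : ℝ → ℝ → ℝ) : ManyBody :=
  fun _ z => ∑ i, betheMomenta ψ z i ^ 2 / 2

/-- The function `s ψ`. -/
def scaled (s : ℝ) (ψ : ℝ → ℝ → ℝ) : ℝ → ℝ → ℝ := fun x θ => s * ψ x θ

/-! ### Strongly monotone maps and global inverses -/

/-! In the mixed coordinates `(x, θ)`, the relation splits into two explicit maps: `betheSource`,
giving `(y, θ)`, and `betheTarget`, giving `(x, p)`. Both ψ_x and ψ_θ are odd, and ψ_{xθ} ≥ 0 makes
ψ_x monotone in θ and ψ_θ monotone in x. Hence y at fixed θ, and p at fixed x, are the identity plus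
a monotone map. Such maps are antilipschitz with invertible derivative, so both halves are
bijections with C¹ inverses.

The formulas have the generating function Φ = ∑ x_i θ_i + ½ ∑_{ij} ψ(x_i - x_j, θ_i - θ_j), with y =
Φ_θ and p = Φ_x. Symmetry of the second derivative of ψ therefore makes (y, θ) ↦ (x, p) symplectic
(`symplecticForm_target_eq_source`). In the coordinates (y, θ) the Hamiltonian is the free kinetic
energy. This gives involution of the functions of θ and straight-line motion of y
(`isTrajectory_iff`), hence global existence and uniqueness.

Finite range comes from the support of ψ_x: particles of other clusters drop out of the equations
for θ (`betheMomenta_restrictTo`). For scattering, ψ_θ is bounded in x at fixed θ, so particles with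
distinct θ separate linearly in time. Then ψ_x vanishes and ψ_θ is frozen at its value at x = ±ε,
which yields the asymptotic momenta and the shift φ = ψ_θ(ε, ·) - ψ_θ(-ε, ·).

For the flow, the system with coupling u at momenta p is the system with coupling s at momenta p -
(u - s) ∑ ψ_x (`betheMomenta_scaled_eq`). Differentiating at u = s gives -∑_i ẋ_i ∑_j ψ_x, and
antisymmetrising in i, j gives the source with w = ψ_x / 2. -/

theorem dist_le_of_stronglyMonotone {N : ℕ} {u v a b : Fin N → ℝ}
    (h : ∑ i, (u i - v i) ^ 2 ≤ ∑ i, (a i - b i) * (u i - v i)) :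
    dist u v ≤ N * dist a b := by
  rcases (dist_nonneg : 0 ≤ dist u v).eq_or_lt with h0 | h0
  · rw [← h0]; positivity
  obtain ⟨i, hi⟩ : ∃ i, dist u v ≤ |u i - v i| := by
    by_contra! hc
    exact absurd ((dist_pi_lt_iff h0).2 fun i => by rw [Real.dist_eq]; exact hc i) (lt_irrefl _)
  have h1 : dist u v ^ 2 ≤ ∑ i, (u i - v i) ^ 2 := by
    refine le_trans ?_ (Finset.single_le_sum (fun j _ => sq_nonneg (u j - v j))
      (Finset.mem_univ i))
    rw [← sq_abs (u i - v i)]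
    gcongr
  have h2 : ∑ i, (a i - b i) * (u i - v i) ≤ ∑ _i : Fin N, dist a b * dist u v := by
    refine Finset.sum_le_sum fun j _ => (le_abs_self _).trans ?_
    rw [abs_mul]
    exact mul_le_mul (dist_le_pi_dist a b j) (dist_le_pi_dist u v j) (abs_nonneg _) dist_nonneg
  simp only [Finset.sum_const, Finset.card_univ, Fintype.card_fin, nsmul_eq_mul] at h2
  nlinarith

/-- The lower bound on difference quotients along `v` survives the limit, so a vector killed by the
derivative has norm zero. -/
theorem AntilipschitzWith.hasFDerivAt_injective {E F : Type*} [NormedAddCommGroup E]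
    [NormedSpace ℝ E] [NormedAddCommGroup F] [NormedSpace ℝ F] {K : NNReal} {f : E → F}
    {f' : E →L[ℝ] F} {u : E} (hf : AntilipschitzWith K f) (h : HasFDerivAt f f' u) :
    Function.Injective f' := by
  refine (injective_iff_map_eq_zero f').2 fun v hv => ?_
  have h1 := (h.hasLineDerivAt v).tendsto_slope_zero
  simp only [hv] at h1
  have h2 : ∀ᶠ t : ℝ in 𝓝[≠] 0, ‖v‖ ≤ K * ‖t⁻¹ • (f (u + t • v) - f u)‖ := by
    filter_upwards [self_mem_nhdsWithin] with t ht
    have h3 := hf.le_mul_dist (u + t • v) u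
    rw [dist_eq_norm, dist_eq_norm, add_sub_cancel_left, norm_smul] at h3
    have h4 : 0 < ‖t‖ := norm_pos_iff.2 ht
    rw [norm_smul, norm_inv]
    calc ‖v‖ = ‖t‖⁻¹ * (‖t‖ * ‖v‖) := by field_simp
      _ ≤ ‖t‖⁻¹ * (K * ‖f (u + t • v) - f u‖) := by gcongr
      _ = _ := by ring
  have h5 := ge_of_tendsto ((h1.norm).const_mul (K : ℝ)) h2
  simpa using h5

theorem exists_continuousLinearEquiv_of_injective {E : Type*} [NormedAddCommGroup E]
    [NormedSpace ℝ E] [FiniteDimensional ℝ E] (A : E →L[ℝ] E) (hA : Function.Injective A) :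
    ∃ e : E ≃L[ℝ] E, (e : E →L[ℝ] E) = A :=
  ⟨(LinearEquiv.ofInjectiveEndo (A : E →ₗ[ℝ] E) hA).toContinuousLinearEquiv, by ext; rfl⟩

theorem antilipschitz_of_stronglyMonotone {N : ℕ} {f : (Fin N → ℝ) → Fin N → ℝ}
    (hm : ∀ u v, ∑ i, (u i - v i) ^ 2 ≤ ∑ i, (f u i - f v i) * (u i - v i)) :
    AntilipschitzWith N f :=
  AntilipschitzWith.of_le_mul_dist fun u v => by
    simpa using dist_le_of_stronglyMonotone (hm u v)

/-- The range is open by the inverse function theorem. It is closed because preimages of a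
convergent sequence are Cauchy by the antilipschitz bound. Connectedness then gives surjectivity. -/
theorem bijective_of_stronglyMonotone {N : ℕ} {f : (Fin N → ℝ) → Fin N → ℝ}
    (hf : ContDiff ℝ 1 f)
    (hm : ∀ u v, ∑ i, (u i - v i) ^ 2 ≤ ∑ i, (f u i - f v i) * (u i - v i)) :
    Function.Bijective f := by
  have hK := antilipschitz_of_stronglyMonotone hm
  refine ⟨hK.injective, ?_⟩
  have hd : ∀ u, HasStrictFDerivAt f (fderiv ℝ f u) u := fun u =>
    hf.hasStrictFDerivAt one_ne_zero
  choose e he using fun u => exists_continuousLinearEquiv_of_injective (fderiv ℝ f u)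
    (hK.hasFDerivAt_injective (hd u).hasFDerivAt)
  have hopen : IsOpenMap f := isOpenMap_of_hasStrictFDerivAt_equiv (f' := e) fun u => by
    rw [he]; exact hd u
  have hclosed : IsClosed (range f) := by
    refine IsSeqClosed.isClosed fun y z hy hz => ?_
    choose w hw using hy
    have hc : CauchySeq w := by
      have h1 : CauchySeq (f ∘ w) := by
        have : f ∘ w = y := funext hw
        rw [this]; exact hz.cauchySeq
      rw [Metric.cauchySeq_iff'] at h1 ⊢
      intro r hr
      -- `N + 1` in place of `N` keeps the radius meaningful for `N = 0`.
      obtain ⟨n, hn⟩ := h1 (r / (N + 1)) (by positivity)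
      refine ⟨n, fun k hk => ?_⟩
      have h2 := dist_le_of_stronglyMonotone (hm (w k) (w n))
      have h3 := hn k hk
      rw [lt_div_iff₀ (by positivity)] at h3
      simp only [Function.comp_apply] at h3
      nlinarith [dist_nonneg (x := f (w k)) (y := f (w n))]
    obtain ⟨x, hx⟩ := cauchySeq_tendsto_of_complete hc
    refine ⟨x, tendsto_nhds_unique ((hf.continuous.tendsto x).comp hx) ?_⟩
    have : f ∘ w = y := funext hw
    rwa [this]
  exact range_eq_univ.1 (IsClopen.eq_univ ⟨hclosed, hopen.isOpen_range⟩ (range_nonempty f))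

/-- No continuity of `g` is needed: injectivity of `f` forces `g` to agree near each point with the
local inverse from the inverse function theorem. -/
theorem contDiff_of_rightInverse {E : Type*} [NormedAddCommGroup E] [NormedSpace ℝ E]
    [FiniteDimensional ℝ E] {f g : E → E} (hf : ContDiff ℝ 1 f) (hi : Function.Injective f)
    (hd : ∀ u, Function.Injective (fderiv ℝ f u)) (hg : Function.RightInverse g f) :
    ContDiff ℝ 1 g := by
  have : CompleteSpace E := FiniteDimensional.complete ℝ E
  rw [contDiff_iff_contDiffAt]
  intro z
  obtain ⟨e, he⟩ := exists_continuousLinearEquiv_of_injective _ (hd (g z))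
  have h1 : HasStrictFDerivAt f (e : E →L[ℝ] E) (g z) := by
    rw [he]; exact hf.hasStrictFDerivAt one_ne_zero
  have h2 := (hf.contDiffAt (x := g z)).to_localInverse h1.hasFDerivAt one_ne_zero
  rw [hg z] at h2
  refine h2.congr_of_eventuallyEq ?_
  have h3 := h1.eventually_right_inverse
  rw [hg z] at h3
  filter_upwards [h3] with y hy
  exact hi ((hg y).trans hy.symm)

/-! ### The kernel `ψ` -/

/-- The hypotheses on `ψ` under which the Bethe equations are uniquely solvable. -/
structure IsBetheKernel (ψ : ℝ → ℝ → ℝ) : Prop where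
  contDiff : ContDiff ℝ 2 (Function.uncurry ψ)
  mono : ∀ x θ, 0 ≤ dTheta (dX ψ) x θ
  symm : ∀ x θ, ψ (-x) (-θ) = ψ x θ

theorem deriv_fst_eq_fderiv {f : ℝ → ℝ → ℝ} {x θ : ℝ}
    (hf : DifferentiableAt ℝ (Function.uncurry f) (x, θ)) :
    deriv (fun u => f u θ) x = fderiv ℝ (Function.uncurry f) (x, θ) (1, 0) := by
  have h := hf.hasFDerivAt.comp_hasDerivAt x ((hasDerivAt_id x).prodMk (hasDerivAt_const x θ))
  exact h.deriv

theorem deriv_snd_eq_fderiv {f : ℝ → ℝ → ℝ} {x θ : ℝ}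
    (hf : DifferentiableAt ℝ (Function.uncurry f) (x, θ)) :
    deriv (fun t => f x t) θ = fderiv ℝ (Function.uncurry f) (x, θ) (0, 1) := by
  have h := hf.hasFDerivAt.comp_hasDerivAt θ ((hasDerivAt_const θ x).prodMk (hasDerivAt_id θ))
  exact h.deriv

namespace IsBetheKernel

theorem differentiable {ψ : ℝ → ℝ → ℝ} (hψ : IsBetheKernel ψ)
    : Differentiable ℝ (Function.uncurry ψ) :=
  hψ.contDiff.differentiable (by norm_num)

theorem uncurry_dX {ψ : ℝ → ℝ → ℝ} (hψ : IsBetheKernel ψ) :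
    Function.uncurry (dX ψ) = fun q => fderiv ℝ (Function.uncurry ψ) q (1, 0) := by
  funext q
  exact deriv_fst_eq_fderiv (hψ.differentiable _)

theorem uncurry_dTheta {ψ : ℝ → ℝ → ℝ} (hψ : IsBetheKernel ψ) :
    Function.uncurry (dTheta ψ) = fun q => fderiv ℝ (Function.uncurry ψ) q (0, 1) := by
  funext q
  exact deriv_snd_eq_fderiv (hψ.differentiable _)

theorem contDiff_fderiv {ψ : ℝ → ℝ → ℝ} (hψ : IsBetheKernel ψ)
    : ContDiff ℝ 1 (fderiv ℝ (Function.uncurry ψ)) :=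
  hψ.contDiff.fderiv_right (by norm_num)

theorem contDiff_dX {ψ : ℝ → ℝ → ℝ} (hψ : IsBetheKernel ψ)
    : ContDiff ℝ 1 (Function.uncurry (dX ψ)) := by
  rw [hψ.uncurry_dX]
  exact hψ.contDiff_fderiv.clm_apply contDiff_const

theorem contDiff_dTheta {ψ : ℝ → ℝ → ℝ} (hψ : IsBetheKernel ψ)
    : ContDiff ℝ 1 (Function.uncurry (dTheta ψ)) := by
  rw [hψ.uncurry_dTheta]
  exact hψ.contDiff_fderiv.clm_apply contDiff_const

theorem fderiv_dX {ψ : ℝ → ℝ → ℝ} (hψ : IsBetheKernel ψ)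
    (q v : ℝ × ℝ) : fderiv ℝ (Function.uncurry (dX ψ)) q v =
    fderiv ℝ (fderiv ℝ (Function.uncurry ψ)) q v (1, 0) := by
  rw [hψ.uncurry_dX, fderiv_clm_apply (hψ.contDiff_fderiv.differentiable one_ne_zero q)
    (differentiableAt_const _)]
  simp

theorem fderiv_dTheta {ψ : ℝ → ℝ → ℝ} (hψ : IsBetheKernel ψ)
    (q v : ℝ × ℝ) : fderiv ℝ (Function.uncurry (dTheta ψ)) q v =
    fderiv ℝ (fderiv ℝ (Function.uncurry ψ)) q v (0, 1) := by
  rw [hψ.uncurry_dTheta, fderiv_clm_apply (hψ.contDiff_fderiv.differentiable one_ne_zero q)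
    (differentiableAt_const _)]
  simp

theorem hessian_symm {ψ : ℝ → ℝ → ℝ} (hψ : IsBetheKernel ψ) (q v w : ℝ × ℝ) :
    fderiv ℝ (fderiv ℝ (Function.uncurry ψ)) q v w =
      fderiv ℝ (fderiv ℝ (Function.uncurry ψ)) q w v :=
  (hψ.contDiff.contDiffAt.isSymmSndFDerivAt (by simp)) v w

/-- Both sides are the second derivative of ψ on the pair `v`, `w`. This is the two-body core of
symplecticity. -/
theorem fderiv_pairing_symm {ψ : ℝ → ℝ → ℝ} (hψ : IsBetheKernel ψ) (q v w : ℝ × ℝ) :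
    v.1 * fderiv ℝ (Function.uncurry (dX ψ)) q w + v.2 * fderiv ℝ (Function.uncurry (dTheta ψ)) q w
      = w.1 * fderiv ℝ (Function.uncurry (dX ψ)) q v
        + w.2 * fderiv ℝ (Function.uncurry (dTheta ψ)) q v := by
  have key : ∀ v w : ℝ × ℝ, v.1 * fderiv ℝ (Function.uncurry (dX ψ)) q w
      + v.2 * fderiv ℝ (Function.uncurry (dTheta ψ)) q w =
        fderiv ℝ (fderiv ℝ (Function.uncurry ψ)) q w v := by
    intro v w
    rw [hψ.fderiv_dX, hψ.fderiv_dTheta]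
    have : v = v.1 • ((1, 0) : ℝ × ℝ) + v.2 • ((0, 1) : ℝ × ℝ) := by ext <;> simp
    conv_rhs => rw [this, map_add, map_smul, map_smul, smul_eq_mul, smul_eq_mul]
  rw [key, key, hψ.hessian_symm]

theorem dX_odd {ψ : ℝ → ℝ → ℝ} (hψ : IsBetheKernel ψ) (x θ : ℝ) : dX ψ (-x) (-θ) = -dX ψ x θ := by
  have : (fun u => ψ u (-θ)) = fun u => ψ (-u) θ := by
    funext u; rw [← hψ.symm u (-θ), neg_neg]
  rw [dX, this, deriv_comp_neg (fun u => ψ u θ), neg_neg, dX]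

theorem dTheta_odd {ψ : ℝ → ℝ → ℝ} (hψ : IsBetheKernel ψ)
    (x θ : ℝ) : dTheta ψ (-x) (-θ) = -dTheta ψ x θ := by
  have : (fun u => ψ (-x) u) = fun u => ψ x (-u) := by
    funext u; rw [← hψ.symm (-x) u, neg_neg]
  rw [dTheta, this, deriv_comp_neg (fun u => ψ x u), neg_neg, dTheta]

theorem monotone_dX {ψ : ℝ → ℝ → ℝ} (hψ : IsBetheKernel ψ) (x : ℝ) : Monotone (dX ψ x) := by
  refine monotone_of_deriv_nonneg (fun θ => ?_) fun θ => hψ.mono x θ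
  exact ((hψ.contDiff_dX.differentiable one_ne_zero).comp
    ((differentiable_const x).prodMk differentiable_id)) θ

/-- Symmetry of the Hessian turns the hypothesis on ψ_{xθ} into one on ψ_{θx}. -/
theorem monotone_dTheta {ψ : ℝ → ℝ → ℝ} (hψ : IsBetheKernel ψ)
    (θ : ℝ) : Monotone fun x => dTheta ψ x θ := by
  refine monotone_of_deriv_nonneg (fun x => ?_) fun x => ?_
  · exact ((hψ.contDiff_dTheta.differentiable one_ne_zero).comp
      (differentiable_id.prodMk (differentiable_const θ))) x
  · have h := hψ.mono x θ
    rw [dTheta, deriv_snd_eq_fderiv (hψ.contDiff_dX.differentiable one_ne_zero _),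
      hψ.fderiv_dX, hψ.hessian_symm, ← hψ.fderiv_dTheta] at h
    rwa [deriv_fst_eq_fderiv (hψ.contDiff_dTheta.differentiable one_ne_zero _)]

end IsBetheKernel

/-! ### Rescaling the kernel -/

theorem dX_scaled (s : ℝ) (ψ : ℝ → ℝ → ℝ) (x θ : ℝ) : dX (scaled s ψ) x θ = s * dX ψ x θ := by
  simp only [dX, scaled, deriv_const_mul_field]

theorem dTheta_scaled (s : ℝ) (ψ : ℝ → ℝ → ℝ) (x θ : ℝ) :
    dTheta (scaled s ψ) x θ = s * dTheta ψ x θ := by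
  simp only [dTheta, scaled, deriv_const_mul_field]

theorem IsBetheKernel.scaled {ψ : ℝ → ℝ → ℝ} (hψ : IsBetheKernel ψ) {s : ℝ} (hs : 0 ≤ s) :
    IsBetheKernel (scaled s ψ) where
  contDiff := contDiff_const.mul hψ.contDiff
  mono x θ := by
    have : dX (_root_.scaled s ψ) = _root_.scaled s (dX ψ) := by
      funext x θ; exact dX_scaled s ψ x θ
    rw [this, dTheta_scaled]
    exact mul_nonneg hs (hψ.mono x θ)
  symm x θ := by simp only [_root_.scaled, hψ.symm]

/-! ### The two halves of the Bethe relation -/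

/-- The pair of differences `(x_i - x_j, θ_i - θ_j)`. -/
noncomputable def pairDiff {N : ℕ} (i j : Fin N) : Phase N →L[ℝ] ℝ × ℝ :=
  (ContinuousLinearMap.proj (R := ℝ) (φ := fun _ : Fin N => ℝ) i
    - ContinuousLinearMap.proj j).prodMap
  (ContinuousLinearMap.proj (R := ℝ) (φ := fun _ : Fin N => ℝ) i - ContinuousLinearMap.proj j)

@[simp]
theorem pairDiff_apply {N : ℕ} (i j : Fin N) (u : Phase N) :
    pairDiff i j u = (u.1 i - u.1 j, u.2 i - u.2 j) := rfl

theorem pairDiff_swap {N : ℕ} (i j : Fin N) (u : Phase N) :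
    pairDiff i j u = -pairDiff j i u := by
  simp

/-- The sums `∑ j, f (x_i - x_j, θ_i - θ_j)` of two-body terms. -/
noncomputable def pairSum {N : ℕ} (f : ℝ → ℝ → ℝ) (u : Phase N) (i : Fin N) : ℝ :=
  ∑ j, f (u.1 i - u.1 j) (u.2 i - u.2 j)

/-- The map `(x, θ) ↦ (y, θ)` of the Bethe relation. -/
noncomputable def betheSource {N : ℕ} (ψ : ℝ → ℝ → ℝ) (u : Phase N) : Phase N :=
  (u.1 + pairSum (dTheta ψ) u, u.2)

/-- The map `(x, θ) ↦ (x, p)` of the Bethe relation. -/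
noncomputable def betheTarget {N : ℕ} (ψ : ℝ → ℝ → ℝ) (u : Phase N) : Phase N :=
  (u.1, u.2 + pairSum (dX ψ) u)

/-- The map `(x, p) ↦ (x, θ)`. -/
noncomputable def betheLift {N : ℕ} (ψ : ℝ → ℝ → ℝ) (z : Phase N) : Phase N :=
  (z.1, betheMomenta ψ z)

/-- Exchanging the indices averages `w i` with `-w j`. This converts one-particle sums to pair sums
for monotonicity, symplecticity and the flow equation. -/
theorem sum_sum_mul_of_antisymm {ι : Type*} [Fintype ι] {c : ι → ι → ℝ}
    (hc : ∀ i j, c i j = -c j i) (w : ι → ℝ) :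
    ∑ i, (∑ j, c i j) * w i = 1 / 2 * ∑ i, ∑ j, c i j * (w i - w j) := by
  have h1 : ∑ i, ∑ j, c i j * w j = -∑ i, ∑ j, c i j * w i := by
    rw [Finset.sum_comm, ← Finset.sum_neg_distrib]
    refine Finset.sum_congr rfl fun i _ => ?_
    rw [← Finset.sum_neg_distrib]
    refine Finset.sum_congr rfl fun j _ => ?_
    rw [hc j i]; ring
  simp only [mul_sub, Finset.sum_sub_distrib, Finset.sum_mul, h1]
  ring

section PairSum

variable {N : ℕ} {f : ℝ → ℝ → ℝ}

theorem contDiff_pairSum (hf : ContDiff ℝ 1 (Function.uncurry f)) :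
    ContDiff ℝ 1 (pairSum f : Phase N → Fin N → ℝ) := by
  refine contDiff_pi.2 fun i => ContDiff.sum fun j _ => ?_
  exact hf.comp (pairDiff i j).contDiff

theorem fderiv_pairSum (hf : ContDiff ℝ 1 (Function.uncurry f)) (u v : Phase N) (i : Fin N) :
    fderiv ℝ (pairSum f) u v i =
      ∑ j, fderiv ℝ (Function.uncurry f) (pairDiff i j u) (pairDiff i j v) := by
  have h : HasFDerivAt (pairSum f) (ContinuousLinearMap.pi fun i => ∑ j,
      (fderiv ℝ (Function.uncurry f) (pairDiff i j u)).comp (pairDiff i j)) u := by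
    refine hasFDerivAt_pi.2 fun i => ?_
    refine (HasFDerivAt.fun_sum fun j _ =>
      (hf.differentiable one_ne_zero (pairDiff i j u)).hasFDerivAt.comp u
        (pairDiff i j).hasFDerivAt).congr_of_eventuallyEq (Eventually.of_forall fun w => ?_)
    simp [pairSum]
  rw [h.fderiv]
  simp

/-- After antisymmetrisation, each pair contributes an increment of a monotone function times the
increment of its argument. -/
theorem pairSum_mono_snd (ho : ∀ x θ, f (-x) (-θ) = -f x θ) (hm : ∀ x, Monotone (f x))
    (x θ θ' : Fin N → ℝ) :
    0 ≤ ∑ i, (pairSum f (x, θ) i - pairSum f (x, θ') i) * (θ i - θ' i) := by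
  simp only [pairSum, ← Finset.sum_sub_distrib]
  rw [sum_sum_mul_of_antisymm (c := fun i j => f (x i - x j) (θ i - θ j)
    - f (x i - x j) (θ' i - θ' j)) ?_ (fun i => θ i - θ' i)]
  · refine mul_nonneg (by norm_num) (Finset.sum_nonneg fun i _ => Finset.sum_nonneg fun j _ => ?_)
    rcases le_total (θ i - θ j) (θ' i - θ' j) with h | h
    · exact mul_nonneg_of_nonpos_of_nonpos (sub_nonpos.2 (hm _ h)) (by linarith)
    · exact mul_nonneg (sub_nonneg.2 (hm _ h)) (by linarith)
  · intro i j
    rw [← neg_sub (x j), ← neg_sub (θ j), ← neg_sub (θ' j), ho, ho]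
    ring

theorem pairSum_mono_fst (ho : ∀ x θ, f (-x) (-θ) = -f x θ) (hm : ∀ θ, Monotone fun x => f x θ)
    (θ x x' : Fin N → ℝ) :
    0 ≤ ∑ i, (pairSum f (x, θ) i - pairSum f (x', θ) i) * (x i - x' i) :=
  pairSum_mono_snd (f := fun x θ => f θ x) (fun x θ => ho θ x) hm θ x x'

/-- An odd function vanishes at the origin, so the diagonal term may be kept. -/
theorem sum_erase_eq_pairSum (ho : ∀ x θ, f (-x) (-θ) = -f x θ) (u : Phase N) (i : Fin N) :
    ∑ j ∈ Finset.univ.erase i, f (u.1 i - u.1 j) (u.2 i - u.2 j) = pairSum f u i := by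
  refine Finset.sum_erase _ ?_
  have := ho 0 0
  simp only [neg_zero] at this
  simp only [sub_self]
  linarith

end PairSum

namespace IsBetheKernel

variable {ψ : ℝ → ℝ → ℝ} {N : ℕ}

theorem betheRel_iff (hψ : IsBetheKernel ψ) (q z : Phase N) : BetheRel ψ q z ↔
    q = betheSource ψ (z.1, q.2) ∧ z = betheTarget ψ (z.1, q.2) := by
  unfold BetheRel betheSource betheTarget
  simp only [Prod.ext_iff, funext_iff, Pi.add_apply, and_true, true_and,
    ← sum_erase_eq_pairSum hψ.dX_odd, ← sum_erase_eq_pairSum hψ.dTheta_odd]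

theorem contDiff_betheSource (hψ : IsBetheKernel ψ) :
    ContDiff ℝ 1 (betheSource ψ : Phase N → Phase N) :=
  (contDiff_fst.add (contDiff_pairSum hψ.contDiff_dTheta)).prodMk contDiff_snd

theorem contDiff_betheTarget (hψ : IsBetheKernel ψ) :
    ContDiff ℝ 1 (betheTarget ψ : Phase N → Phase N) :=
  contDiff_fst.prodMk (contDiff_snd.add (contDiff_pairSum hψ.contDiff_dX))

theorem fderiv_betheSource (hψ : IsBetheKernel ψ) (u v : Phase N) :
    fderiv ℝ (betheSource ψ) u v = (v.1 + fderiv ℝ (pairSum (dTheta ψ)) u v, v.2) := by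
  have h := ((contDiff_pairSum (N := N) hψ.contDiff_dTheta).differentiable one_ne_zero u).hasFDerivAt
  have h1 : HasFDerivAt (betheSource ψ) _ u := (hasFDerivAt_fst.add h).prodMk hasFDerivAt_snd
  rw [h1.fderiv]
  rfl

theorem fderiv_betheTarget (hψ : IsBetheKernel ψ) (u v : Phase N) :
    fderiv ℝ (betheTarget ψ) u v = (v.1, v.2 + fderiv ℝ (pairSum (dX ψ)) u v) := by
  have h := ((contDiff_pairSum (N := N) hψ.contDiff_dX).differentiable one_ne_zero u).hasFDerivAt
  have h1 : HasFDerivAt (betheTarget ψ) _ u := hasFDerivAt_fst.prodMk (hasFDerivAt_snd.add h)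
  rw [h1.fderiv]
  rfl

theorem stronglyMonotone_source (hψ : IsBetheKernel ψ) (θ x x' : Fin N → ℝ) :
    ∑ i, (x i - x' i) ^ 2 ≤ ∑ i, ((betheSource ψ (x, θ)).1 i - (betheSource ψ (x', θ)).1 i)
      * (x i - x' i) := by
  have h := pairSum_mono_fst hψ.dTheta_odd hψ.monotone_dTheta θ x x'
  rw [← sub_nonneg, ← Finset.sum_sub_distrib]
  refine h.trans_eq (Finset.sum_congr rfl fun i _ => ?_)
  simp only [betheSource, Pi.add_apply]
  ring

theorem stronglyMonotone_target (hψ : IsBetheKernel ψ) (x θ θ' : Fin N → ℝ) :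
    ∑ i, (θ i - θ' i) ^ 2 ≤ ∑ i, ((betheTarget ψ (x, θ)).2 i - (betheTarget ψ (x, θ')).2 i)
      * (θ i - θ' i) := by
  have h := pairSum_mono_snd hψ.dX_odd hψ.monotone_dX x θ θ'
  rw [← sub_nonneg, ← Finset.sum_sub_distrib]
  refine h.trans_eq (Finset.sum_congr rfl fun i _ => ?_)
  simp only [betheTarget, Pi.add_apply]
  ring

/-- The map preserves θ, so it suffices to invert it in x at each fixed θ. -/
theorem bijective_betheSource (hψ : IsBetheKernel ψ) :
    Function.Bijective (betheSource ψ : Phase N → Phase N) := by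
  have h : ∀ θ, Function.Bijective fun x : Fin N → ℝ => (betheSource ψ (x, θ)).1 := fun θ =>
    bijective_of_stronglyMonotone
      (hψ.contDiff_betheSource.comp (contDiff_id.prodMk contDiff_const)).fst
      (hψ.stronglyMonotone_source θ)
  refine ⟨fun u v huv => ?_, fun q => ?_⟩
  · obtain ⟨x, θ⟩ := u
    obtain ⟨x', θ'⟩ := v
    obtain rfl : θ = θ' := congrArg Prod.snd huv
    rw [(h θ).injective (congrArg Prod.fst huv)]
  · obtain ⟨x, hx⟩ := (h q.2).surjective q.1
    exact ⟨(x, q.2), Prod.ext hx rfl⟩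

theorem bijective_betheTarget (hψ : IsBetheKernel ψ) :
    Function.Bijective (betheTarget ψ : Phase N → Phase N) := by
  have h : ∀ x, Function.Bijective fun θ : Fin N → ℝ => (betheTarget ψ (x, θ)).2 := fun x =>
    bijective_of_stronglyMonotone
      (hψ.contDiff_betheTarget.comp (contDiff_const.prodMk contDiff_id)).snd
      (hψ.stronglyMonotone_target x)
  refine ⟨fun u v huv => ?_, fun q => ?_⟩
  · obtain ⟨x, θ⟩ := u
    obtain ⟨x', θ'⟩ := v
    obtain rfl : x = x' := congrArg Prod.fst huv
    rw [(h x).injective (congrArg Prod.snd huv)]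
  · obtain ⟨θ, hθ⟩ := (h q.1).surjective q.2
    exact ⟨(q.1, θ), Prod.ext rfl hθ⟩

/-- The derivative is block triangular: its θ-block is the identity, and its x-block is the
derivative of an antilipschitz map. -/
theorem fderiv_betheSource_injective (hψ : IsBetheKernel ψ) (u : Phase N) :
    Function.Injective (fderiv ℝ (betheSource ψ) u) := by
  refine (injective_iff_map_eq_zero _).2 fun v hv => ?_
  have h2 : v.2 = 0 := by
    have := congrArg Prod.snd (hψ.fderiv_betheSource u v)
    rw [hv] at this
    exact this.symm
  have hd := (hψ.contDiff_betheSource.differentiable one_ne_zero u).hasFDerivAt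
  have hc := HasFDerivAt.comp (f := fun x : Fin N → ℝ => (x, u.2)) u.1 hd.fst
    (hasFDerivAt_prodMk_left u.1 u.2)
  have h1 : v.1 = 0 := by
    refine (injective_iff_map_eq_zero _).1 ((antilipschitz_of_stronglyMonotone
      (hψ.stronglyMonotone_source u.2)).hasFDerivAt_injective hc) _ ?_
    have hv' : ((v.1, 0) : Phase N) = v := Prod.ext rfl h2.symm
    simp [hv', hv]
  exact Prod.ext h1 h2

theorem fderiv_betheTarget_injective (hψ : IsBetheKernel ψ) (u : Phase N) :
    Function.Injective (fderiv ℝ (betheTarget ψ) u) := by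
  refine (injective_iff_map_eq_zero _).2 fun v hv => ?_
  have h1 : v.1 = 0 := by
    have := congrArg Prod.fst (hψ.fderiv_betheTarget u v)
    rw [hv] at this
    exact this.symm
  have hd := (hψ.contDiff_betheTarget.differentiable one_ne_zero u).hasFDerivAt
  have hc := HasFDerivAt.comp (f := fun θ : Fin N → ℝ => (u.1, θ)) u.2 hd.snd
    (hasFDerivAt_prodMk_right u.1 u.2)
  have h2 : v.2 = 0 := by
    refine (injective_iff_map_eq_zero _).1 ((antilipschitz_of_stronglyMonotone
      (hψ.stronglyMonotone_target u.1)).hasFDerivAt_injective hc) _ ?_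
    have hv' : ((0, v.2) : Phase N) = v := Prod.ext h1.symm rfl
    simp [hv', hv]
  exact Prod.ext h1 h2

/-! ### Solvability of the Bethe relation and regularity of the Bethe momenta -/

theorem existsUnique_target (hψ : IsBetheKernel ψ) (q : Phase N) :
    ∃! z : Phase N, BetheRel ψ q z := by
  obtain ⟨u, rfl⟩ := hψ.bijective_betheSource.surjective q
  refine ⟨betheTarget ψ u, (hψ.betheRel_iff _ _).2 ⟨rfl, rfl⟩, fun z hz => ?_⟩
  replace hz := (hψ.betheRel_iff _ _).1 hz
  have h := hψ.bijective_betheSource.injective hz.1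
  rw [hz.2, ← h]

theorem existsUnique_source (hψ : IsBetheKernel ψ) (z : Phase N) :
    ∃! q : Phase N, BetheRel ψ q z := by
  obtain ⟨u, rfl⟩ := hψ.bijective_betheTarget.surjective z
  refine ⟨betheSource ψ u, (hψ.betheRel_iff _ _).2 ⟨rfl, rfl⟩, fun q hq => ?_⟩
  replace hq := (hψ.betheRel_iff _ _).1 hq
  have h := hψ.bijective_betheTarget.injective hq.2
  rw [hq.1, ← h]

theorem betheMomenta_target (hψ : IsBetheKernel ψ) (u : Phase N) :
    betheMomenta ψ (betheTarget ψ u) = u.2 := by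
  have h := Classical.epsilon_spec (hψ.existsUnique_source (betheTarget ψ u)).exists
  rw [hψ.betheRel_iff] at h
  exact (congrArg Prod.snd (hψ.bijective_betheTarget.injective h.2)).symm

theorem betheLift_target (hψ : IsBetheKernel ψ) (u : Phase N) :
    betheLift ψ (betheTarget ψ u) = u :=
  Prod.ext rfl (hψ.betheMomenta_target u)

theorem target_betheLift (hψ : IsBetheKernel ψ) (z : Phase N) :
    betheTarget ψ (betheLift ψ z) = z := by
  obtain ⟨u, rfl⟩ := hψ.bijective_betheTarget.surjective z
  rw [hψ.betheLift_target]

/-- The Bethe equations determine the momenta. -/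
theorem betheMomenta_eq (hψ : IsBetheKernel ψ) {z : Phase N} {θ : Fin N → ℝ}
    (h : ∀ i, z.2 i = θ i + pairSum (dX ψ) (z.1, θ) i) : betheMomenta ψ z = θ := by
  have : z = betheTarget ψ (z.1, θ) := Prod.ext rfl (funext h)
  rw [this, hψ.betheMomenta_target]

theorem betheMomenta_spec (hψ : IsBetheKernel ψ) (z : Phase N) (i : Fin N) :
    z.2 i = betheMomenta ψ z i + pairSum (dX ψ) (z.1, betheMomenta ψ z) i :=
  (congrFun (congrArg Prod.snd (hψ.target_betheLift z)) i).symm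

theorem contDiff_betheLift (hψ : IsBetheKernel ψ) :
    ContDiff ℝ 1 (betheLift ψ : Phase N → Phase N) :=
  contDiff_of_rightInverse hψ.contDiff_betheTarget hψ.bijective_betheTarget.injective
    hψ.fderiv_betheTarget_injective hψ.target_betheLift

theorem contDiff_betheMomenta (hψ : IsBetheKernel ψ) :
    ContDiff ℝ 1 (betheMomenta ψ : Phase N → Fin N → ℝ) :=
  hψ.contDiff_betheLift.snd

/-- The inverse of `betheSource`. -/
theorem exists_contDiff_inverse_source (hψ : IsBetheKernel ψ) :
    ∃ g : Phase N → Phase N, ContDiff ℝ 1 g ∧ (∀ q, betheSource ψ (g q) = q) ∧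
      ∀ u, g (betheSource ψ u) = u := by
  obtain ⟨g, hg⟩ := hψ.bijective_betheSource.surjective.hasRightInverse
  exact ⟨g, contDiff_of_rightInverse hψ.contDiff_betheSource hψ.bijective_betheSource.injective
    hψ.fderiv_betheSource_injective hg, hg, fun u => hψ.bijective_betheSource.injective (hg _)⟩

theorem fderiv_betheTarget_lift (hψ : IsBetheKernel ψ) (z v : Phase N) :
    fderiv ℝ (betheTarget ψ) (betheLift ψ z) (fderiv ℝ (betheLift ψ) z v) = v := by
  have h := (hψ.contDiff_betheTarget.differentiable one_ne_zero (betheLift ψ z)).hasFDerivAt.comp z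
    (hψ.contDiff_betheLift.differentiable one_ne_zero z).hasFDerivAt
  rw [show betheTarget ψ ∘ betheLift ψ = (id : Phase N → Phase N) from
    funext hψ.target_betheLift] at h
  exact congrArg (fun A : Phase N →L[ℝ] Phase N => A v) (h.unique (hasFDerivAt_id z))

theorem fderiv_betheLift_target (hψ : IsBetheKernel ψ) (z v : Phase N) :
    fderiv ℝ (betheLift ψ) z (fderiv ℝ (betheTarget ψ) (betheLift ψ z) v) = v :=
  hψ.fderiv_betheTarget_injective (betheLift ψ z) (hψ.fderiv_betheTarget_lift z _)

end IsBetheKernel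

/-! ### Hamiltonian vector fields -/

/-- The canonical symplectic form. -/
def symplecticForm {N : ℕ} (v w : Phase N) : ℝ := ∑ i, (v.1 i * w.2 i - v.2 i * w.1 i)

/-- The Hamiltonian vector field. -/
noncomputable def hamiltonianField {N : ℕ} (F : Phase N → ℝ) (z : Phase N) : Phase N :=
  (velocity F z, force F z)

section HamiltonianField

variable {N : ℕ}

theorem velocity_eq (F : Phase N → ℝ) (z : Phase N) (i : Fin N) :
    velocity F z i = fderiv ℝ F z (0, Pi.single i 1) := by
  have h : fderiv ℝ (fun u : Phase N => u.1 i) z =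
      (ContinuousLinearMap.proj i).comp (ContinuousLinearMap.fst ℝ _ _) :=
    ((ContinuousLinearMap.proj (R := ℝ) (φ := fun _ : Fin N => ℝ) i).comp
      (ContinuousLinearMap.fst ℝ _ (Fin N → ℝ))).fderiv
  simp [velocity, poisson, h, Pi.single_apply]

theorem force_eq (F : Phase N → ℝ) (z : Phase N) (i : Fin N) :
    force F z i = -fderiv ℝ F z (Pi.single i 1, 0) := by
  have h : fderiv ℝ (fun u : Phase N => u.2 i) z =
      (ContinuousLinearMap.proj i).comp (ContinuousLinearMap.snd ℝ _ _) :=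
    ((ContinuousLinearMap.proj (R := ℝ) (φ := fun _ : Fin N => ℝ) i).comp
      (ContinuousLinearMap.snd ℝ (Fin N → ℝ) _)).fderiv
  simp [force, poisson, h, Pi.single_apply]

theorem clm_apply_eq_sum (L : (Fin N → ℝ) →L[ℝ] ℝ) (v : Fin N → ℝ) :
    L v = ∑ i, v i * L (Pi.single i 1) := by
  conv_lhs => rw [pi_eq_sum_univ' v, map_sum]
  simp

theorem phase_clm_apply_eq_sum (L : Phase N →L[ℝ] ℝ) (v : Phase N) :
    L v = ∑ i, (v.1 i * L (Pi.single i 1, 0) + v.2 i * L (0, Pi.single i 1)) := by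
  have h1 := clm_apply_eq_sum (L.comp (ContinuousLinearMap.inl ℝ _ _)) v.1
  have h2 := clm_apply_eq_sum (L.comp (ContinuousLinearMap.inr ℝ _ _)) v.2
  simp only [ContinuousLinearMap.comp_apply, ContinuousLinearMap.inl_apply,
    ContinuousLinearMap.inr_apply] at h1 h2
  rw [Finset.sum_add_distrib, ← h1, ← h2, ← map_add]
  simp

theorem poisson_eq (F G : Phase N → ℝ) (z : Phase N) :
    poisson F G z = fderiv ℝ F z (hamiltonianField G z) := by
  rw [phase_clm_apply_eq_sum, poisson]
  refine Finset.sum_congr rfl fun i _ => ?_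
  simp only [hamiltonianField, velocity_eq, force_eq]
  ring

/-- Nondegeneracy of the symplectic form, tested on coordinate vectors. -/
theorem hamiltonianField_eq {F : Phase N → ℝ} {z X : Phase N}
    (h : ∀ v, fderiv ℝ F z v = symplecticForm X v) : hamiltonianField F z = X := by
  refine Prod.ext (funext fun i => ?_) (funext fun i => ?_)
  · simp [hamiltonianField, velocity_eq, h, symplecticForm, Pi.single_apply]
  · simp [hamiltonianField, force_eq, h, symplecticForm, Pi.single_apply]

end HamiltonianField

/-! ### Symplecticity and involution -/

namespace IsBetheKernel

variable {ψ : ℝ → ℝ → ℝ} {N : ℕ}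

theorem fderiv_antisymm {f : ℝ → ℝ → ℝ} (hf : ∀ x θ, f (-x) (-θ) = -f x θ) (u v : Phase N)
    (i j : Fin N) : fderiv ℝ (Function.uncurry f) (pairDiff i j u) (pairDiff i j v) =
      -fderiv ℝ (Function.uncurry f) (pairDiff j i u) (pairDiff j i v) := by
  have h : Function.uncurry f = fun q => -Function.uncurry f (-q) := by
    funext q
    simp [Function.uncurry, hf]
  have h1 : ∀ q : ℝ × ℝ, fderiv ℝ (Function.uncurry f) (-q) = fderiv ℝ (Function.uncurry f) q := by
    intro q
    conv_rhs => rw [h]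
    rw [fderiv_fun_neg, show (fun q : ℝ × ℝ => Function.uncurry f (-q)) =
      fun q => Function.uncurry f ((-1 : ℝ) • q) by simp, fderiv_comp_smul]
    simp
  rw [pairDiff_swap, h1, pairDiff_swap i j v, map_neg]

/-- The Bethe relation is a symplectic correspondence. -/
theorem symplecticForm_target_eq_source (hψ : IsBetheKernel ψ) (u v w : Phase N) :
    symplecticForm (fderiv ℝ (betheTarget ψ) u v) (fderiv ℝ (betheTarget ψ) u w) =
      symplecticForm (fderiv ℝ (betheSource ψ) u v) (fderiv ℝ (betheSource ψ) u w) := by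
  -- The right side is the second derivative of ½ ∑_{ij} ψ(x_i - x_j, θ_i - θ_j), hence symmetric in
  -- `v` and `w`.
  have key : ∀ v w : Phase N, ∑ i, fderiv ℝ (pairSum (dX ψ)) u w i * v.1 i
      + ∑ i, fderiv ℝ (pairSum (dTheta ψ)) u w i * v.2 i =
      1 / 2 * ∑ i, ∑ j, ((pairDiff i j v).1 *
        fderiv ℝ (Function.uncurry (dX ψ)) (pairDiff i j u) (pairDiff i j w)
        + (pairDiff i j v).2 *
          fderiv ℝ (Function.uncurry (dTheta ψ)) (pairDiff i j u) (pairDiff i j w)) := by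
    intro v w
    simp only [fderiv_pairSum hψ.contDiff_dX, fderiv_pairSum hψ.contDiff_dTheta]
    rw [sum_sum_mul_of_antisymm (fderiv_antisymm hψ.dX_odd u w),
      sum_sum_mul_of_antisymm (fderiv_antisymm hψ.dTheta_odd u w), ← mul_add,
      ← Finset.sum_add_distrib]
    simp only [← Finset.sum_add_distrib, pairDiff_apply, mul_comm]
  have h : ∑ i, fderiv ℝ (pairSum (dX ψ)) u w i * v.1 i
      + ∑ i, fderiv ℝ (pairSum (dTheta ψ)) u w i * v.2 i =
      ∑ i, fderiv ℝ (pairSum (dX ψ)) u v i * w.1 i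
      + ∑ i, fderiv ℝ (pairSum (dTheta ψ)) u v i * w.2 i := by
    rw [key, key]
    simp only [hψ.fderiv_pairing_symm _ (pairDiff _ _ v)]
  -- The identity parts of the two maps cancel between the two forms; what remains is the asymmetry
  -- that `h` shows to be zero.
  rw [← sub_eq_zero] at h ⊢
  simp only [← Finset.sum_add_distrib, ← Finset.sum_sub_distrib] at h
  rw [symplecticForm, symplecticForm, ← Finset.sum_sub_distrib, ← h]
  refine Finset.sum_congr rfl fun i _ => ?_
  simp only [hψ.fderiv_betheSource, hψ.fderiv_betheTarget, Pi.add_apply]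
  ring

theorem fderiv_comp_betheMomenta (hψ : IsBetheKernel ψ) {f : (Fin N → ℝ) → ℝ} {z : Phase N}
    (hf : DifferentiableAt ℝ f (betheMomenta ψ z)) (v : Phase N) :
    fderiv ℝ (fun z => f (betheMomenta ψ z)) z (fderiv ℝ (betheTarget ψ) (betheLift ψ z) v) =
      fderiv ℝ f (betheMomenta ψ z) v.2 := by
  have h := (hψ.contDiff_betheLift.differentiable one_ne_zero z).hasFDerivAt
  have h1 := HasFDerivAt.comp (f := betheMomenta ψ) z hf.hasFDerivAt h.snd
  change fderiv ℝ (f ∘ betheMomenta ψ) z _ = _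
  rw [h1.fderiv]
  simp only [ContinuousLinearMap.comp_apply, hψ.fderiv_betheLift_target]
  rfl

/-- In the coordinates `(y, θ)` the Hamiltonian field of f(θ) is `(∇f, 0)`. The vector `v`
represents it in `(x, θ)`, and symplecticity carries it over to `(x, p)`. -/
theorem hamiltonianField_comp_betheMomenta (hψ : IsBetheKernel ψ) {f : (Fin N → ℝ) → ℝ}
    {z : Phase N} (hf : DifferentiableAt ℝ f (betheMomenta ψ z)) {v : Phase N}
    (hv : fderiv ℝ (betheSource ψ) (betheLift ψ z) v =
      (fun i => fderiv ℝ f (betheMomenta ψ z) (Pi.single i 1), 0)) :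
    hamiltonianField (fun z => f (betheMomenta ψ z)) z =
      fderiv ℝ (betheTarget ψ) (betheLift ψ z) v := by
  refine hamiltonianField_eq fun w => ?_
  rw [← hψ.fderiv_betheTarget_lift z w, hψ.fderiv_comp_betheMomenta hf,
    hψ.symplecticForm_target_eq_source, hv, clm_apply_eq_sum, symplecticForm]
  refine Finset.sum_congr rfl fun i _ => ?_
  rw [hψ.fderiv_betheSource _ (fderiv ℝ (betheLift ψ) z w)]
  simp [mul_comm]

theorem surjective_fderiv_betheSource (hψ : IsBetheKernel ψ) (u : Phase N) :
    Function.Surjective (fderiv ℝ (betheSource ψ) u) :=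
  LinearMap.surjective_of_injective (f := (fderiv ℝ (betheSource ψ) u).toLinearMap)
    (hψ.fderiv_betheSource_injective u)

/-- Functions of the Bethe momenta are in involution. -/
theorem poisson_comp_betheMomenta (hψ : IsBetheKernel ψ) {f g : (Fin N → ℝ) → ℝ} {z : Phase N}
    (hf : DifferentiableAt ℝ f (betheMomenta ψ z)) (hg : DifferentiableAt ℝ g (betheMomenta ψ z)) :
    poisson (fun z => f (betheMomenta ψ z)) (fun z => g (betheMomenta ψ z)) z = 0 := by
  obtain ⟨v, hv⟩ := hψ.surjective_fderiv_betheSource (betheLift ψ z)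
    (fun i => fderiv ℝ g (betheMomenta ψ z) (Pi.single i 1), 0)
  rw [poisson_eq, hψ.hamiltonianField_comp_betheMomenta hg hv, hψ.fderiv_comp_betheMomenta hf]
  have : v.2 = 0 := by
    rw [hψ.fderiv_betheSource] at hv
    exact congrArg Prod.snd hv
  rw [this, map_zero]

/-- The target map is continuous and surjective, so it carries dense sets to dense sets. A linear
relation among the composed differentials is tested on the images of the vectors `(0, w)`. -/
theorem functionallyIndependent_comp_betheMomenta (hψ : IsBetheKernel ψ) {n : ℕ}
    {f : Fin n → (Fin N → ℝ) → ℝ} (hf : ∀ a, Differentiable ℝ (f a))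
    (hd : Dense {q : Phase N | LinearIndependent ℝ fun a => fderiv ℝ (f a) q.2}) :
    FunctionallyIndependent fun a (z : Phase N) => f a (betheMomenta ψ z) := by
  have h := hψ.bijective_betheTarget.surjective.denseRange.dense_image
    hψ.contDiff_betheTarget.continuous hd
  refine h.mono ?_
  rintro _ ⟨u, hu, rfl⟩
  simp only [mem_ofPred_eq] at hu ⊢
  rw [Fintype.linearIndependent_iff] at hu ⊢
  intro c hc
  refine hu c (ContinuousLinearMap.ext fun w => ?_)
  have h1 := congrArg (fun L : Phase N →L[ℝ] ℝ => L (fderiv ℝ (betheTarget ψ)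
    (betheLift ψ (betheTarget ψ u)) (0, w))) hc
  simpa [sum_apply, hψ.fderiv_comp_betheMomenta (hf _ _),
    hψ.betheMomenta_target] using h1

/-! ### Dynamics -/

theorem source_lift_snd (ψ : ℝ → ℝ → ℝ) (z : Phase N) :
    (betheSource ψ (betheLift ψ z)).2 = betheMomenta ψ z := rfl

theorem hasFDerivAt_kinetic (θ : Fin N → ℝ) : HasFDerivAt (fun θ : Fin N → ℝ => ∑ i, θ i ^ 2 / 2)
    (∑ i, θ i • ContinuousLinearMap.proj (R := ℝ) (φ := fun _ : Fin N => ℝ) i) θ := by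
  refine HasFDerivAt.fun_sum fun i _ => ?_
  have h := ((hasFDerivAt_apply (𝕜 := ℝ) i θ).pow 2).mul_const (1 / 2)
  refine (h.congr_fderiv ?_).congr_of_eventuallyEq (Eventually.of_forall fun x => ?_)
  · ext; simp; ring
  · ring

theorem hamiltonianField_betheHamiltonian (hψ : IsBetheKernel ψ) {z v : Phase N}
    (hv : fderiv ℝ (betheSource ψ) (betheLift ψ z) v = (betheMomenta ψ z, 0)) :
    hamiltonianField (betheHamiltonian ψ N) z = fderiv ℝ (betheTarget ψ) (betheLift ψ z) v := by
  have h := hasFDerivAt_kinetic (betheMomenta ψ z)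
  refine hψ.hamiltonianField_comp_betheMomenta h.differentiableAt ?_
  rw [hv, h.fderiv]
  refine Prod.ext (funext fun i => ?_) rfl
  simp [Pi.single_apply]

/-- The Bethe relation conjugates the dynamics to free motion. -/
theorem isTrajectory_iff (hψ : IsBetheKernel ψ) (γ : ℝ → Phase N) :
    IsTrajectory (betheHamiltonian ψ N) γ ↔
      ∃ q : Phase N, ∀ t, betheSource ψ (betheLift ψ (γ t)) = (q.1 + t • q.2, q.2) := by
  constructor
  · intro hγ
    set Q : ℝ → Phase N := fun t => betheSource ψ (betheLift ψ (γ t)) with hQ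
    have h1 : ∀ t, HasDerivAt Q ((Q t).2, 0) t := by
      intro t
      obtain ⟨v, hv⟩ := hψ.surjective_fderiv_betheSource (betheLift ψ (γ t))
        (betheMomenta ψ (γ t), 0)
      have h2 : HasDerivAt γ (hamiltonianField (betheHamiltonian ψ N) (γ t)) t := hγ t
      rw [hψ.hamiltonianField_betheHamiltonian hv] at h2
      have h3 := (hψ.contDiff_betheLift.differentiable one_ne_zero
        (γ t)).hasFDerivAt.comp_hasDerivAt t h2
      rw [hψ.fderiv_betheLift_target] at h3
      have h4 := (hψ.contDiff_betheSource.differentiable one_ne_zero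
        (betheLift ψ (γ t))).hasFDerivAt.comp_hasDerivAt t h3
      rw [hv] at h4
      exact h4
    have ha : ∀ t, HasDerivAt (fun t => (Q t).1) (Q t).2 t := fun t =>
      (ContinuousLinearMap.fst ℝ (Fin N → ℝ) (Fin N → ℝ)).hasFDerivAt.comp_hasDerivAt t (h1 t)
    have hb : ∀ t, HasDerivAt (fun t => (Q t).2) 0 t := fun t =>
      (ContinuousLinearMap.snd ℝ (Fin N → ℝ) (Fin N → ℝ)).hasFDerivAt.comp_hasDerivAt t (h1 t)
    have h2 : ∀ t, (Q t).2 = (Q 0).2 := fun t =>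
      is_const_of_deriv_eq_zero (f := fun t => (Q t).2) (fun t => (hb t).differentiableAt)
        (fun t => (hb t).deriv) t 0
    have h3 : ∀ t, HasDerivAt (fun t => (Q t).1 - t • (Q 0).2) 0 t := by
      intro t
      have h4 := (ha t).fun_sub ((hasDerivAt_id t).smul_const (Q 0).2)
      simp only [h2, one_smul, sub_self] at h4
      exact h4
    have h4 : ∀ t, (Q t).1 - t • (Q 0).2 = (Q 0).1 := fun t => by
      have := is_const_of_deriv_eq_zero (fun t => (h3 t).differentiableAt)
        (fun t => (h3 t).deriv) t 0
      simpa using this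
    exact ⟨Q 0, fun t => Prod.ext (sub_eq_iff_eq_add.1 (h4 t)) (h2 t)⟩
  · rintro ⟨q, hq⟩ t
    -- Here differentiability of γ is not given; it comes from the C¹ inverse of the source map
    -- applied to the straight line.
    obtain ⟨g, hg, hg1, hg2⟩ := hψ.exists_contDiff_inverse_source (N := N)
    have hu : ∀ t, betheLift ψ (γ t) = g (q.1 + t • q.2, q.2) := fun t => by rw [← hq, hg2]
    have hθ : betheMomenta ψ (γ t) = q.2 := by rw [← source_lift_snd, hq]
    have h1 : HasDerivAt (fun t : ℝ => ((q.1 + t • q.2, q.2) : Phase N)) (q.2, 0) t := by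
      have := (((hasDerivAt_id t).smul_const q.2).const_add q.1).prodMk (hasDerivAt_const t q.2)
      simpa using this
    have h2 := (hg.differentiable one_ne_zero (q.1 + t • q.2, q.2)).hasFDerivAt.comp_hasDerivAt t h1
    rw [show g ∘ (fun t : ℝ => ((q.1 + t • q.2, q.2) : Phase N)) = fun t => betheLift ψ (γ t) from
      funext fun t => (hu t).symm] at h2
    have hs := (hψ.contDiff_betheSource.differentiable one_ne_zero
        (betheLift ψ (γ t))).hasFDerivAt.comp_hasDerivAt t h2
    rw [show betheSource ψ ∘ (fun t => betheLift ψ (γ t)) =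
      fun t : ℝ => ((q.1 + t • q.2, q.2) : Phase N) from funext hq] at hs
    have hv := hs.unique h1
    rw [← hθ] at hv
    have h3 := (hψ.contDiff_betheTarget.differentiable one_ne_zero
        (betheLift ψ (γ t))).hasFDerivAt.comp_hasDerivAt t h2
    rw [hθ] at hv
    rw [show betheTarget ψ ∘ (fun t => betheLift ψ (γ t)) = γ from
      funext fun t => hψ.target_betheLift _] at h3
    rw [← hψ.hamiltonianField_betheHamiltonian (by rw [hv, hθ])] at h3
    exact h3

theorem exists_trajectory (hψ : IsBetheKernel ψ) (z : Phase N) :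
    ∃ γ, IsTrajectory (betheHamiltonian ψ N) γ ∧ γ 0 = z := by
  obtain ⟨g, -, hg1, hg2⟩ := hψ.exists_contDiff_inverse_source (N := N)
  set q := betheSource ψ (betheLift ψ z) with hq
  refine ⟨fun t => betheTarget ψ (g (q.1 + t • q.2, q.2)),
    (hψ.isTrajectory_iff _).2 ⟨q, fun t => ?_⟩, ?_⟩
  · rw [hψ.betheLift_target, hg1]
  · simp only [zero_smul, add_zero, Prod.mk.eta]
    rw [hq, hg2, hψ.target_betheLift]

theorem source_lift_trajectory (hψ : IsBetheKernel ψ) {γ : ℝ → Phase N}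
    (hγ : IsTrajectory (betheHamiltonian ψ N) γ) (t : ℝ) :
    betheSource ψ (betheLift ψ (γ t)) = ((betheSource ψ (betheLift ψ (γ 0))).1
      + t • betheMomenta ψ (γ 0), betheMomenta ψ (γ 0)) := by
  obtain ⟨q, hq⟩ := (hψ.isTrajectory_iff γ).1 hγ
  have h0 := hq 0
  have h2 : betheMomenta ψ (γ 0) = q.2 := by rw [← source_lift_snd, h0]
  rw [hq, h0, h2, zero_smul, add_zero]

/-- The Hamiltonian is only known to be C¹, so its field need not be Lipschitz. Uniqueness comes
from the conjugation to straight lines. -/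
theorem existsUnique_trajectory (hψ : IsBetheKernel ψ) (z : Phase N) :
    ∃! γ, IsTrajectory (betheHamiltonian ψ N) γ ∧ γ 0 = z := by
  obtain ⟨γ, hγ, h0⟩ := hψ.exists_trajectory z
  refine ⟨γ, ⟨hγ, h0⟩, fun δ hδ => funext fun t => ?_⟩
  have h1 := hψ.source_lift_trajectory hδ.1 t
  rw [hδ.2, ← h0, ← hψ.source_lift_trajectory hγ t] at h1
  rw [← hψ.target_betheLift (δ t), hψ.bijective_betheSource.injective h1, hψ.target_betheLift]

theorem contDiff_betheHamiltonian (hψ : IsBetheKernel ψ) :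
    ContDiff ℝ 1 (betheHamiltonian ψ N) :=
  ContDiff.sum fun i _ => (((contDiff_pi.1 hψ.contDiff_betheMomenta i).pow 2).div_const 2)

theorem betheMomenta_relabel (hψ : IsBetheKernel ψ) (σ : Equiv.Perm (Fin N)) (z : Phase N) :
    betheMomenta ψ (z.1 ∘ σ, z.2 ∘ σ) = betheMomenta ψ z ∘ σ := by
  refine hψ.betheMomenta_eq fun i => ?_
  have h := hψ.betheMomenta_spec z (σ i)
  simp only [Function.comp_apply, pairSum] at h ⊢
  rw [h, ← Equiv.sum_comp σ]

theorem isManyBodySystem (hψ : IsBetheKernel ψ) : IsManyBodySystem (betheHamiltonian ψ) where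
  contDiff _ _ := hψ.contDiff_betheHamiltonian
  relabel _ _ σ z := by
    simp only [betheHamiltonian, hψ.betheMomenta_relabel]
    exact Equiv.sum_comp σ fun i => betheMomenta ψ z i ^ 2 / 2
  dynamics _ _ := hψ.existsUnique_trajectory

end IsBetheKernel

/-! ### Generic points -/

section Generic

variable {N : ℕ}

theorem isAddHaarMeasure_volume_phase (N : ℕ) :
    (volume : Measure (Phase N)).IsAddHaarMeasure :=
  Measure.prod.instIsAddHaarMeasure (volume : Measure (Fin N → ℝ)) volume

theorem ae_clm_ne_zero (L : Phase N →L[ℝ] ℝ) (hL : L ≠ 0) : ∀ᵐ q : Phase N, L q ≠ 0 := by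
  have := isAddHaarMeasure_volume_phase N
  have h := Measure.addHaar_submodule (volume : Measure (Phase N)) (L : Phase N →ₗ[ℝ] ℝ).ker
    fun h => hL (ContinuousLinearMap.coe_inj.1 (LinearMap.ker_eq_top.1 h))
  rw [ae_iff]
  simp only [not_not]
  exact h

theorem ae_mem_distinctMomenta : ∀ᵐ q : Phase N, q ∈ distinctMomenta N := by
  unfold distinctMomenta
  simp only [mem_ofPred_eq, ae_all_iff]
  intro i j hij
  have h := ae_clm_ne_zero (((ContinuousLinearMap.proj (R := ℝ) (φ := fun _ : Fin N => ℝ) i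
    - ContinuousLinearMap.proj j)).comp (ContinuousLinearMap.snd ℝ (Fin N → ℝ) _)) fun h => by
      simpa [Pi.single_apply, hij] using
        congrArg (fun L : Phase N →L[ℝ] ℝ => L (0, Pi.single i 1)) h
  filter_upwards [h] with q hq
  simpa [sub_eq_zero] using hq

theorem ae_momenta_ne_zero : ∀ᵐ q : Phase N, ∀ i, q.2 i ≠ 0 := by
  rw [ae_all_iff]
  intro i
  exact ae_clm_ne_zero ((ContinuousLinearMap.proj (R := ℝ) (φ := fun _ : Fin N => ℝ) i).comp
    (ContinuousLinearMap.snd ℝ (Fin N → ℝ) _)) fun h => by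
      simpa using congrArg (fun L : Phase N →L[ℝ] ℝ => L (0, Pi.single i 1)) h

theorem dense_of_ae_phase {p : Phase N → Prop} (h : ∀ᵐ q, p q) : Dense {q | p q} := by
  have := isAddHaarMeasure_volume_phase N
  exact Measure.dense_of_ae h

theorem hasFDerivAt_powerSum (a : ℕ) (θ : Fin N → ℝ) :
    HasFDerivAt (fun θ : Fin N → ℝ => ∑ i, θ i ^ (a + 1))
      (∑ i, (((a : ℝ) + 1) * θ i ^ a) •
        ContinuousLinearMap.proj (R := ℝ) (φ := fun _ : Fin N => ℝ) i) θ := by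
  refine HasFDerivAt.fun_sum fun i _ => ?_
  refine ((hasFDerivAt_apply (𝕜 := ℝ) i θ).pow (a + 1)).congr_fderiv ?_
  ext; simp

/-- A vanishing combination with coefficients `c a` says that the Vandermonde matrix of θ kills the
vector with entries `c a * (a + 1)`. -/
theorem linearIndependent_fderiv_powerSum {θ : Fin N → ℝ} (hθ : Function.Injective θ) :
    LinearIndependent ℝ fun a : Fin N =>
      fderiv ℝ (fun θ : Fin N → ℝ => ∑ i, θ i ^ ((a : ℕ) + 1)) θ := by
  rw [Fintype.linearIndependent_iff]
  intro c hc
  have h : (Matrix.vandermonde θ).mulVec (fun a => c a * ((a : ℝ) + 1)) = 0 := by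
    funext i
    have h1 := congrArg (fun L : (Fin N → ℝ) →L[ℝ] ℝ => L (Pi.single i 1)) hc
    simp only [(hasFDerivAt_powerSum _ θ).fderiv] at h1
    simp only [sum_apply, smul_apply, ContinuousLinearMap.proj_apply, Pi.single_apply,
      smul_eq_mul, mul_ite, mul_one, mul_zero, Finset.sum_ite_eq', Finset.mem_univ, if_true,
      zero_apply] at h1
    rw [Pi.zero_apply, ← h1]
    simp only [Matrix.mulVec, dotProduct, Matrix.vandermonde_apply]
    exact Finset.sum_congr rfl fun a _ => by ring
  intro a
  have h2 := congrFun (Matrix.eq_zero_of_mulVec_eq_zero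
    (Matrix.det_vandermonde_ne_zero_iff.2 hθ) h) a
  exact (mul_eq_zero.1 h2).resolve_right (by positivity)

theorem linearIndependent_fderiv_sq {θ : Fin N → ℝ} (hθ : ∀ i, θ i ≠ 0) :
    LinearIndependent ℝ fun a : Fin N => fderiv ℝ (fun θ : Fin N → ℝ => θ a ^ 2 / 2) θ := by
  have h : ∀ a : Fin N, fderiv ℝ (fun θ : Fin N → ℝ => θ a ^ 2 / 2) θ =
      θ a • ContinuousLinearMap.proj (R := ℝ) (φ := fun _ : Fin N => ℝ) a := by
    intro a
    have h := ((hasFDerivAt_apply (𝕜 := ℝ) a θ).pow 2).mul_const (1 / 2)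
    refine ((h.congr_fderiv ?_).congr_of_eventuallyEq (Eventually.of_forall fun x => ?_)).fderiv
    · ext; simp; ring
    · ring
  simp only [h]
  rw [Fintype.linearIndependent_iff]
  intro c hc a
  have h1 := congrArg (fun L : (Fin N → ℝ) →L[ℝ] ℝ => L (Pi.single a 1)) hc
  simp [sum_apply, Pi.single_apply] at h1
  exact h1.resolve_right (hθ a)

end Generic

/-! ### Clusters -/

section Clusters

variable {N : ℕ} {ε : ℝ}

theorem SameCluster.symm {x : Fin N → ℝ} {i j : Fin N} (h : SameCluster ε x i j) :
    SameCluster ε x j i :=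
  have : Std.Symm fun i j => |x i - x j| ≤ ε := ⟨fun i j h => by rwa [abs_sub_comm]⟩
  Relation.ReflTransGen.stdSymm.symm _ _ h

theorem mem_cluster {x : Fin N → ℝ} {i j : Fin N} : j ∈ cluster ε x i ↔ SameCluster ε x i j := by
  simp [cluster]

theorem cluster_eq_iff {x : Fin N → ℝ} {i j : Fin N} :
    cluster ε x j = cluster ε x i ↔ j ∈ cluster ε x i := by
  refine ⟨fun h => h ▸ mem_cluster.2 Relation.ReflTransGen.refl, fun h => ?_⟩
  rw [mem_cluster] at h
  ext k
  rw [mem_cluster, mem_cluster]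
  exact ⟨fun hk => h.trans hk, fun hk => h.symm.trans hk⟩

theorem sum_clusters (x : Fin N → ℝ) (f : Fin N → ℝ) :
    ∑ I ∈ clusters ε x, ∑ i ∈ I, f i = ∑ i, f i := by
  rw [← Finset.sum_fiberwise_of_maps_to (s := Finset.univ) (t := clusters ε x) (g := cluster ε x)
    fun i _ => Finset.mem_image_of_mem _ (Finset.mem_univ i)]
  refine Finset.sum_congr rfl fun I hI => ?_
  obtain ⟨i, -, rfl⟩ := Finset.mem_image.1 hI
  refine Finset.sum_congr ?_ fun _ _ => rfl
  ext j
  simp [cluster_eq_iff]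

theorem lt_abs_sub_of_notMem {x : Fin N → ℝ} {I : Finset (Fin N)} (hI : I ∈ clusters ε x)
    {i j : Fin N} (hi : i ∈ I) (hj : j ∉ I) : ε < |x i - x j| := by
  obtain ⟨k, -, rfl⟩ := Finset.mem_image.1 hI
  by_contra! h
  exact hj (mem_cluster.2 ((mem_cluster.1 hi).tail h))

theorem sum_orderEmbOfFin (I : Finset (Fin N)) (f : Fin N → ℝ) :
    ∑ r, f (I.orderEmbOfFin rfl r) = ∑ i ∈ I, f i := by
  conv_rhs => rw [← Finset.map_orderEmbOfFin_univ I rfl, Finset.sum_map]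
  rfl

end Clusters

theorem pairSum_scaled {N : ℕ} (s : ℝ) (ψ : ℝ → ℝ → ℝ) (u : Phase N) :
    pairSum (dX (scaled s ψ)) u = s • pairSum (dX ψ) u := by
  funext i
  simp only [pairSum, dX_scaled, Pi.smul_apply, smul_eq_mul, Finset.mul_sum]

/-- The slope at `s` is `G` itself, so continuity of `G` suffices. -/
theorem hasDerivWithinAt_sub_smul {E : Type*} [NormedAddCommGroup E] [NormedSpace ℝ E]
    {G : ℝ → E} {S : Set ℝ} {s : ℝ} (hG : ContinuousWithinAt G S s) :
    HasDerivWithinAt (fun u => (u - s) • G u) (G s) S s := by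
  rw [hasDerivWithinAt_iff_tendsto_slope]
  refine (hG.mono_left (nhdsWithin_mono s sdiff_subset)).congr' ?_
  filter_upwards [self_mem_nhdsWithin] with u hu
  have : u - s ≠ 0 := sub_ne_zero.2 hu.2
  simp [slope_def_module, smul_smul, this]

namespace IsBetheKernel

variable {ψ : ℝ → ℝ → ℝ} {N : ℕ} {ε : ℝ}

theorem dX_zero (hψ : IsBetheKernel ψ) : dX ψ 0 0 = 0 := by
  have := hψ.dX_odd 0 0
  simp only [neg_zero] at this
  linarith

/-! ### Decoupling of the clusters and conserved charges -/

/-- Particles outside the cluster are farther than ε and contribute no ψ_x. The restricted momenta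
thus solve the cluster's own Bethe equations, whose solution is unique. -/
theorem betheMomenta_restrictTo (hψ : IsBetheKernel ψ) (hr : ∀ x θ, ε ≤ |x| → dX ψ x θ = 0)
    (z : Phase N) {I : Finset (Fin N)} (hI : I ∈ clusters ε z.1) (r : Fin I.card) :
    betheMomenta ψ (restrictTo z I) r = betheMomenta ψ z (I.orderEmbOfFin rfl r) := by
  refine congrFun (hψ.betheMomenta_eq (z := restrictTo z I)
    (θ := fun r => betheMomenta ψ z (I.orderEmbOfFin rfl r)) fun r => ?_) r
  refine (hψ.betheMomenta_spec z (I.orderEmbOfFin rfl r)).trans ?_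
  congr 1
  simp only [pairSum, restrictTo]
  rw [sum_orderEmbOfFin I fun j => dX ψ (z.1 (I.orderEmbOfFin rfl r) - z.1 j)
    (betheMomenta ψ z (I.orderEmbOfFin rfl r) - betheMomenta ψ z j)]
  refine (Finset.sum_subset (Finset.subset_univ I) fun j _ hj => hr _ _ ?_).symm
  exact (lt_abs_sub_of_notMem hI (Finset.orderEmbOfFin_mem I rfl r) hj).le

theorem clusterCharge_eq (hψ : IsBetheKernel ψ) (hr : ∀ x θ, ε ≤ |x| → dX ψ x θ = 0) (a : ℕ)
    (z : Phase N) : clusterCharge ε (fun p => p ^ (a + 1))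
      (fun _ z => ∑ r, (betheMomenta ψ z r ^ (a + 1) - z.2 r ^ (a + 1))) N z =
      ∑ i, betheMomenta ψ z i ^ (a + 1) := by
  have h : ∀ I ∈ clusters ε z.1,
      ∑ r, (betheMomenta ψ (restrictTo z I) r ^ (a + 1) - (restrictTo z I).2 r ^ (a + 1)) =
        ∑ i ∈ I, (betheMomenta ψ z i ^ (a + 1) - z.2 i ^ (a + 1)) := by
    intro I hI
    rw [← sum_orderEmbOfFin I]
    exact Finset.sum_congr rfl fun r _ => by rw [hψ.betheMomenta_restrictTo hr z hI r]; rfl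
  rw [clusterCharge, Finset.sum_congr rfl h, sum_clusters, Finset.sum_sub_distrib]
  ring

theorem functionallyIndependent_powerSum (hψ : IsBetheKernel ψ) :
    FunctionallyIndependent fun (a : Fin N) (z : Phase N) =>
      ∑ i, betheMomenta ψ z i ^ ((a : ℕ) + 1) :=
  hψ.functionallyIndependent_comp_betheMomenta
    (f := fun a θ => ∑ i, θ i ^ ((a : ℕ) + 1))
    (fun a θ => (hasFDerivAt_powerSum a θ).differentiableAt)
    ((dense_of_ae_phase ae_mem_distinctMomenta).mono fun q hq =>
      linearIndependent_fderiv_powerSum fun i j hij => by_contra fun h =>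
        (show ∀ i j, i ≠ j → q.2 i ≠ q.2 j from hq) i j h hij)

theorem isLiouvilleIntegrable (hψ : IsBetheKernel ψ) (hN : 1 ≤ N) :
    IsLiouvilleIntegrable (betheHamiltonian ψ N) := by
  have hd : ∀ a : Fin N, Differentiable ℝ fun θ : Fin N → ℝ => θ a ^ 2 / 2 := fun a => by
    fun_prop
  refine ⟨fun a z => betheMomenta ψ z a ^ 2 / 2, fun _ => 1, fun a => ?_, ?_, fun a b z => ?_,
    fun h => ?_, fun z => ?_⟩
  · exact (hd a).comp (hψ.contDiff_betheMomenta.differentiable one_ne_zero)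
  · exact hψ.functionallyIndependent_comp_betheMomenta (f := fun a θ => θ a ^ 2 / 2) hd
      ((dense_of_ae_phase ae_momenta_ne_zero).mono fun _ hq => linearIndependent_fderiv_sq hq)
  · exact hψ.poisson_comp_betheMomenta (hd a _) (hd b _)
  · exact one_ne_zero (congrFun h ⟨0, hN⟩)
  · simp [betheHamiltonian]

theorem betheMomenta_scaled_zero (hψ : IsBetheKernel ψ) (z : Phase N) :
    betheMomenta (_root_.scaled 0 ψ) z = z.2 :=
  (hψ.scaled le_rfl).betheMomenta_eq fun i => by simp [pairSum_scaled]

theorem isFiniteRangeLiouville (hψ : IsBetheKernel ψ) (hr : ∀ x θ, ε ≤ |x| → dX ψ x θ = 0) :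
    IsFiniteRangeLiouville ε (fun a p => p ^ (a + 1)) (Finsupp.single 1 (1 / 2))
      (betheHamiltonian ψ) := by
  have hs : ∀ N, ContDiff ℝ 1 (betheMomenta ψ : Phase N → Fin N → ℝ) := fun N =>
    hψ.contDiff_betheMomenta
  refine ⟨by simp, fun a => contDiff_id.pow _, fun N hN => hψ.isLiouvilleIntegrable hN,
    fun N _ => ?_, fun a _ z => ∑ r, (betheMomenta ψ z r ^ (a + 1) - z.2 r ^ (a + 1)),
    fun a n => ?_, fun a z => ?_, fun N _ => ?_⟩
  -- Free power sums are the charges of the kernel `0 • ψ`.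
  · simpa only [hψ.betheMomenta_scaled_zero] using
      (hψ.scaled le_rfl).functionallyIndependent_powerSum (N := N)
  · refine ContDiff.sum fun r _ => ContDiff.sub ?_ ?_
    · exact (contDiff_pi.1 (hs n) r).pow _
    · exact ((contDiff_apply ℝ ℝ r).comp contDiff_snd).pow _
  · beta_reduce
    rw [hψ.betheMomenta_eq (z := z) (θ := z.2) fun i => ?_]
    · simp
    · simp [pairSum, Subsingleton.elim i 0, hψ.dX_zero]
  · have hq : ∀ a, clusterCharge ε (fun p => p ^ (a + 1))
        (fun _ z => ∑ r, (betheMomenta ψ z r ^ (a + 1) - z.2 r ^ (a + 1))) N =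
        fun z => ∑ i, betheMomenta ψ z i ^ (a + 1) := fun a => funext (hψ.clusterCharge_eq hr a)
    simp only [hq]
    refine ⟨fun a => ContDiff.sum fun i _ => (contDiff_pi.1 (hs N) i).pow _,
      hψ.functionallyIndependent_powerSum, fun a b z => ?_, fun z => ?_⟩
    · exact hψ.poisson_comp_betheMomenta (hasFDerivAt_powerSum a _).differentiableAt
        (hasFDerivAt_powerSum b _).differentiableAt
    -- Index 1 carries the exponent 2, so the single term is half the second charge.
    · rw [Finsupp.support_single _ (by norm_num), Finset.sum_singleton,
        Finsupp.single_eq_same, Finset.mul_sum]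
      exact Finset.sum_congr rfl fun i _ => by ring

/-! ### The flow equation -/

/-- With `g` the pair sum at θ^s, the target map with coupling `u` sends θ^u to `p = θ^s + s • g`
and θ^s to `θ^s + u • g`. Strong monotonicity bounds the distance of θ^u and θ^s by `N * ‖(u - s) •
g‖`. -/
theorem continuousWithinAt_betheMomenta_scaled (hψ : IsBetheKernel ψ) {s : ℝ} (hs : 0 ≤ s)
    (z : Phase N) :
    ContinuousWithinAt (fun u => betheMomenta (_root_.scaled u ψ) z) (Ici 0) s := by
  set θ := betheMomenta (_root_.scaled s ψ) z with hθ
  set g := pairSum (dX ψ) (z.1, θ) with hg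
  have h0 : Tendsto (fun u : ℝ => N * ‖(u - s) • g‖) (𝓝[Ici 0] s) (𝓝 0) := by
    have : Continuous fun u : ℝ => N * ‖(u - s) • g‖ := by fun_prop
    simpa using (this.tendsto s).mono_left nhdsWithin_le_nhds
  rw [ContinuousWithinAt, tendsto_iff_dist_tendsto_zero]
  refine tendsto_of_tendsto_of_tendsto_of_le_of_le' tendsto_const_nhds h0
    (Eventually.of_forall fun _ => dist_nonneg) ?_
  filter_upwards [self_mem_nhdsWithin] with u hu
  refine (dist_le_of_stronglyMonotone
    ((hψ.scaled hu).stronglyMonotone_target z.1 _ _)).trans_eq ?_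
  have h1 : (betheTarget (_root_.scaled u ψ) (z.1, betheMomenta (_root_.scaled u ψ) z)).2 = z.2 :=
    congrArg Prod.snd ((hψ.scaled hu).target_betheLift z)
  have h2 : θ + s • g = z.2 := by
    rw [hg, ← pairSum_scaled]
    exact congrArg Prod.snd ((hψ.scaled hs).target_betheLift z)
  have h3 : (betheTarget (_root_.scaled u ψ) (z.1, θ)).2 = θ + u • g := by
    rw [hg, ← pairSum_scaled]; rfl
  rw [h1, ← hθ, h3, ← h2, dist_comm, dist_eq_norm, add_sub_add_left_eq_sub, sub_smul]

/-- The system `u ψ` at `(x, p)` is the system `s ψ` at shifted momenta. -/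
theorem betheMomenta_scaled_eq (hψ : IsBetheKernel ψ) {s u : ℝ} (hs : 0 ≤ s) (hu : 0 ≤ u)
    (z : Phase N) : betheMomenta (_root_.scaled u ψ) z = betheMomenta (_root_.scaled s ψ)
      (z.1, z.2 - (u - s) • pairSum (dX ψ) (z.1, betheMomenta (_root_.scaled u ψ) z)) := by
  refine ((hψ.scaled hs).betheMomenta_eq fun i => ?_).symm
  have h := (hψ.scaled hu).betheMomenta_spec z i
  simp only [pairSum_scaled, Pi.sub_apply, Pi.smul_apply, smul_eq_mul] at h ⊢
  linarith

theorem ttbarSource_eq (hψ : IsBetheKernel ψ) (H : Phase N → ℝ) (z : Phase N) (θ : Fin N → ℝ) :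
    ttbarSource (fun x θ => dX ψ x θ / 2) H z θ =
      fderiv ℝ H z (0, -pairSum (dX ψ) (z.1, θ)) := by
  have h := sum_sum_mul_of_antisymm
    (c := fun i j => dX ψ (z.1 i - z.1 j) (θ i - θ j))
    (fun i j => by rw [← hψ.dX_odd, neg_sub, neg_sub]) (velocity H z)
  rw [phase_clm_apply_eq_sum, ttbarSource]
  simp only [Pi.zero_apply, zero_mul, zero_add, Pi.neg_apply, neg_mul, Finset.sum_neg_distrib,
    ← velocity_eq, neg_inj]
  refine Eq.trans ?_ h.symm
  simp only [Finset.mul_sum]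
  exact Finset.sum_congr rfl fun i _ => Finset.sum_congr rfl fun j _ => by ring

/-- All dependence on `u` is moved into the momentum argument of the fixed C¹ function H_s. The
shift carries a factor `u - s`, so θ^u need only be continuous in `u`. -/
theorem hasDerivWithinAt_betheHamiltonian (hψ : IsBetheKernel ψ) {s : ℝ} (hs : 0 ≤ s)
    (z : Phase N) : HasDerivWithinAt (fun u : ℝ => betheHamiltonian (_root_.scaled u ψ) N z)
      (ttbarSource (fun x θ => dX ψ x θ / 2) (betheHamiltonian (_root_.scaled s ψ) N) z
        (betheMomenta (_root_.scaled s ψ) z)) (Ici 0) s := by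
  set G : ℝ → Fin N → ℝ := fun u =>
    pairSum (dX ψ) (z.1, betheMomenta (_root_.scaled u ψ) z) with hG
  have hc : ContinuousWithinAt G (Ici 0) s := by
    have h1 : Continuous fun θ : Fin N → ℝ => pairSum (dX ψ) (z.1, θ) :=
      (contDiff_pairSum hψ.contDiff_dX).continuous.comp (by fun_prop)
    exact h1.continuousAt.comp_continuousWithinAt (hψ.continuousWithinAt_betheMomenta_scaled hs z)
  have h1 : HasDerivWithinAt (fun u => ((z.1, z.2 - (u - s) • G u) : Phase N)) (0, -G s)
      (Ici 0) s :=
    (hasDerivWithinAt_const s _ z.1).prodMk ((hasDerivWithinAt_sub_smul hc).const_sub z.2)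
  have hz : ((z.1, z.2 - (s - s) • G s) : Phase N) = z := by simp
  have h2 := ((hψ.scaled hs).contDiff_betheHamiltonian.differentiable one_ne_zero
    ((z.1, z.2 - (s - s) • G s) : Phase N)).hasFDerivAt.comp_hasDerivWithinAt s h1
  rw [hz, ← hψ.ttbarSource_eq] at h2
  have h3 : ∀ u ∈ Ici (0 : ℝ), betheHamiltonian (_root_.scaled u ψ) N z =
      (betheHamiltonian (_root_.scaled s ψ) N ∘ fun u => (z.1, z.2 - (u - s) • G u)) u := by
    intro u hu
    simp only [betheHamiltonian, Function.comp_apply, hG, ← hψ.betheMomenta_scaled_eq hs hu]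
  exact h2.congr h3 (h3 s hs)

end IsBetheKernel

namespace IsBetheKernel

variable {ψ : ℝ → ℝ → ℝ} {N : ℕ} {ε : ℝ}

/-! ### Scattering -/

/-- On a convex set where ψ_x vanishes, ψ does not depend on x, for any θ; differentiating in θ
preserves this. -/
theorem eqOn_of_dX_eq_zero (hψ : IsBetheKernel ψ) {D : Set ℝ} (hD : Convex ℝ D)
    (h : ∀ x ∈ D, ∀ θ, dX ψ x θ = 0) {x y : ℝ} (hx : x ∈ D) (hy : y ∈ D) (θ : ℝ) :
    dTheta ψ x θ = dTheta ψ y θ := by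
  have hd : ∀ θ, Differentiable ℝ fun x => ψ x θ := fun θ =>
    hψ.differentiable.comp (differentiable_id.prodMk (differentiable_const θ))
  have key : ψ x = ψ y := by
    funext θ
    have h1 : MonotoneOn (fun x => ψ x θ) D := monotoneOn_of_deriv_nonneg hD
      (hd θ).continuous.continuousOn (hd θ).differentiableOn
      fun x hx => (h x (interior_subset hx) θ).ge
    have h2 : AntitoneOn (fun x => ψ x θ) D := antitoneOn_of_deriv_nonpos hD
      (hd θ).continuous.continuousOn (hd θ).differentiableOn
      fun x hx => (h x (interior_subset hx) θ).le
    rcases le_total x y with hxy | hxy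
    · exact le_antisymm (h1 hx hy hxy) (h2 hx hy hxy)
    · exact le_antisymm (h2 hy hx hxy) (h1 hy hx hxy)
  simp only [dTheta, key]

theorem dTheta_of_le (hψ : IsBetheKernel ψ) (hr : ∀ x θ, ε ≤ |x| → dX ψ x θ = 0) {x : ℝ}
    (hx : ε ≤ x) (θ : ℝ) : dTheta ψ x θ = dTheta ψ ε θ :=
  hψ.eqOn_of_dX_eq_zero (convex_Ici ε) (fun x hx θ => hr x θ (le_trans hx (le_abs_self x)))
    hx self_mem_Ici θ

theorem dTheta_of_le_neg (hψ : IsBetheKernel ψ) (hr : ∀ x θ, ε ≤ |x| → dX ψ x θ = 0) {x : ℝ}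
    (hx : x ≤ -ε) (θ : ℝ) : dTheta ψ x θ = dTheta ψ (-ε) θ :=
  hψ.eqOn_of_dX_eq_zero (convex_Iic (-ε))
    (fun x hx θ => hr x θ (le_trans (le_neg_of_le_neg hx) (neg_le_abs x))) hx self_mem_Iic θ

/-- Monotonicity in x, with constancy beyond ±ε, traps ψ_θ between its values at -ε and ε. -/
theorem exists_abs_dTheta_le (hψ : IsBetheKernel ψ) (hr : ∀ x θ, ε ≤ |x| → dX ψ x θ = 0)
    (θ : ℝ) : ∃ C, ∀ x, |dTheta ψ x θ| ≤ C := by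
  refine ⟨max |dTheta ψ (-ε) θ| |dTheta ψ ε θ|, fun x => ?_⟩
  refine abs_le_max_abs_abs ?_ ?_
  · rw [← hψ.dTheta_of_le_neg hr (min_le_right x (-ε))]
    exact hψ.monotone_dTheta θ (min_le_left x _)
  · rw [← hψ.dTheta_of_le hr (le_max_right x ε)]
    exact hψ.monotone_dTheta θ (le_max_left x _)

theorem betheMomenta_trajectory (hψ : IsBetheKernel ψ) {γ : ℝ → Phase N}
    (hγ : IsTrajectory (betheHamiltonian ψ N) γ) (t : ℝ) :
    betheMomenta ψ (γ t) = betheMomenta ψ (γ 0) := by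
  rw [← source_lift_snd, hψ.source_lift_trajectory hγ]

/-- Bethe equations for the positions along a trajectory. -/
theorem position_trajectory (hψ : IsBetheKernel ψ) {γ : ℝ → Phase N}
    (hγ : IsTrajectory (betheHamiltonian ψ N) γ) (t : ℝ) (i : Fin N) :
    (γ t).1 i = (betheSource ψ (betheLift ψ (γ 0))).1 i + t * betheMomenta ψ (γ 0) i -
      ∑ j, dTheta ψ ((γ t).1 i - (γ t).1 j) (betheMomenta ψ (γ 0) i - betheMomenta ψ (γ 0) j) := by
  have h := congrFun (congrArg Prod.fst (hψ.source_lift_trajectory hγ t)) i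
  rw [← hψ.betheMomenta_trajectory hγ t] at h ⊢
  simp only [betheSource, betheLift, pairSum, Pi.add_apply, Pi.smul_apply, smul_eq_mul] at h ⊢
  linarith

/-- Faster particles get ahead, at `t → ∞` for `e = 1` and at `t → -∞` for `e = -1`. -/
theorem tendsto_position_sub (hψ : IsBetheKernel ψ) (hr : ∀ x θ, ε ≤ |x| → dX ψ x θ = 0)
    {γ : ℝ → Phase N} (hγ : IsTrajectory (betheHamiltonian ψ N) γ) {l : Filter ℝ} {e : ℝ}
    (he : e * e = 1) (hl : Tendsto (fun t => e * t) l atTop) {i j : Fin N}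
    (hij : 0 < e * (betheMomenta ψ (γ 0) i - betheMomenta ψ (γ 0) j)) :
    Tendsto (fun t => (γ t).1 i - (γ t).1 j) l atTop := by
  set θ := betheMomenta ψ (γ 0)
  choose C hC using fun θ => hψ.exists_abs_dTheta_le hr θ
  have hS : ∀ t k, |∑ j, dTheta ψ ((γ t).1 k - (γ t).1 j) (θ k - θ j)| ≤ ∑ j, C (θ k - θ j) :=
    fun t k => (Finset.abs_sum_le_sum_abs _ _).trans (Finset.sum_le_sum fun j _ => hC _ _)
  -- Lower bound for the separation: free relative motion minus the bounded interaction terms.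
  have h1 : Tendsto (fun t => ((betheSource ψ (betheLift ψ (γ 0))).1 i
      - (betheSource ψ (betheLift ψ (γ 0))).1 j - ∑ k, C (θ i - θ k) - ∑ k, C (θ j - θ k))
      + (e * t) * (e * (θ i - θ j))) l atTop :=
    tendsto_atTop_add_const_left _ _ (hl.atTop_mul_const hij)
  refine tendsto_atTop_mono (fun t => ?_) h1
  have h2 := hψ.position_trajectory hγ t i
  have h3 := hψ.position_trajectory hγ t j
  have h4 := (abs_le.1 (hS t i)).2
  have h5 := (abs_le.1 (hS t j)).1
  have h6 : (e * t) * (e * (θ i - θ j)) = t * θ i - t * θ j := by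
    linear_combination (t * (θ i - θ j)) * he
  rw [h6]
  linarith

theorem eventually_asymptotic (hψ : IsBetheKernel ψ) (hr : ∀ x θ, ε ≤ |x| → dX ψ x θ = 0)
    {γ : ℝ → Phase N} (hγ : IsTrajectory (betheHamiltonian ψ N) γ)
    (hθ : Function.Injective (betheMomenta ψ (γ 0))) {l : Filter ℝ} {e : ℝ}
    (he : e = 1 ∨ e = -1) (hl : Tendsto (fun t => e * t) l atTop) (i j : Fin N) :
    ∀ᶠ t in l,
      dX ψ ((γ t).1 i - (γ t).1 j) (betheMomenta ψ (γ 0) i - betheMomenta ψ (γ 0) j) = 0 ∧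
      dTheta ψ ((γ t).1 i - (γ t).1 j) (betheMomenta ψ (γ 0) i - betheMomenta ψ (γ 0) j) =
        dTheta ψ (e * Real.sign (betheMomenta ψ (γ 0) i - betheMomenta ψ (γ 0) j) * ε)
          (betheMomenta ψ (γ 0) i - betheMomenta ψ (γ 0) j) := by
  set θ := betheMomenta ψ (γ 0)
  have hee : e * e = 1 := by rcases he with rfl | rfl <;> norm_num
  have hsign : Real.sign (e * (θ i - θ j)) = e * Real.sign (θ i - θ j) := by
    rcases he with rfl | rfl
    · simp
    · rw [neg_one_mul, neg_one_mul, Real.sign_neg]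
  rw [← hsign]
  rcases lt_trichotomy (e * (θ i - θ j)) 0 with h | h | h
  · have h1 : 0 < e * (θ j - θ i) := by linarith
    filter_upwards [(hψ.tendsto_position_sub hr hγ hee hl h1).eventually_ge_atTop ε] with t ht
    have h2 : (γ t).1 i - (γ t).1 j ≤ -ε := by linarith
    refine ⟨hr _ _ (le_abs.2 (Or.inr (by linarith))), ?_⟩
    rw [Real.sign_of_neg h, neg_one_mul, hψ.dTheta_of_le_neg hr h2]
  · have he0 : e ≠ 0 := by rintro rfl; norm_num at hee
    obtain rfl : i = j := hθ (sub_eq_zero.1 ((mul_eq_zero.1 h).resolve_left he0))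
    -- On the diagonal the difference of positions is zero and so is the sign, so both values of ψ_θ
    -- are taken at the origin.
    exact Eventually.of_forall fun t => by simp [hψ.dX_zero]
  · filter_upwards [(hψ.tendsto_position_sub hr hγ hee hl h).eventually_ge_atTop ε] with t ht
    refine ⟨hr _ _ (le_abs.2 (Or.inl ht)), ?_⟩
    rw [Real.sign_of_pos h, one_mul, hψ.dTheta_of_le hr ht]

/-- The impact parameters at `t → e ∞`. -/
noncomputable def impact (ψ : ℝ → ℝ → ℝ) (ε e : ℝ) (z : Phase N) (i : Fin N) : ℝ :=
  (betheSource ψ (betheLift ψ z)).1 i - ∑ j,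
    dTheta ψ (e * Real.sign (betheMomenta ψ z i - betheMomenta ψ z j) * ε)
      (betheMomenta ψ z i - betheMomenta ψ z j)

theorem tendsto_momentum (hψ : IsBetheKernel ψ) (hr : ∀ x θ, ε ≤ |x| → dX ψ x θ = 0)
    {γ : ℝ → Phase N} (hγ : IsTrajectory (betheHamiltonian ψ N) γ)
    (hθ : Function.Injective (betheMomenta ψ (γ 0))) {l : Filter ℝ} {e : ℝ}
    (he : e = 1 ∨ e = -1) (hl : Tendsto (fun t => e * t) l atTop) (i : Fin N) :
    Tendsto (fun t => (γ t).2 i) l (𝓝 (betheMomenta ψ (γ 0) i)) := by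
  refine tendsto_const_nhds.congr' ?_
  filter_upwards [eventually_all.2 (hψ.eventually_asymptotic hr hγ hθ he hl i)] with t ht
  rw [hψ.betheMomenta_spec (γ t) i, hψ.betheMomenta_trajectory hγ t, pairSum]
  simp only [fun j => (ht j).1, Finset.sum_const_zero, add_zero]

theorem tendsto_position (hψ : IsBetheKernel ψ) (hr : ∀ x θ, ε ≤ |x| → dX ψ x θ = 0)
    {γ : ℝ → Phase N} (hγ : IsTrajectory (betheHamiltonian ψ N) γ)
    (hθ : Function.Injective (betheMomenta ψ (γ 0))) {l : Filter ℝ} {e : ℝ}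
    (he : e = 1 ∨ e = -1) (hl : Tendsto (fun t => e * t) l atTop) (i : Fin N) :
    Tendsto (fun t => (γ t).1 i - betheMomenta ψ (γ 0) i * t) l (𝓝 (impact ψ ε e (γ 0) i)) := by
  refine tendsto_const_nhds.congr' ?_
  filter_upwards [eventually_all.2 (hψ.eventually_asymptotic hr hγ hθ he hl i)] with t ht
  rw [hψ.position_trajectory hγ t i, impact]
  simp only [fun j => (ht j).2]
  ring

/-- The phase-space points with pairwise distinct Bethe momenta. -/
def scatteringStates (ψ : ℝ → ℝ → ℝ) (N : ℕ) : Set (Phase N) :=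
  {z | Function.Injective (betheMomenta ψ z)}

/-- Coinciding momenta form a null set in `(y, θ)`, and the C¹ map to `(x, p)` sends null sets to
null sets. -/
theorem ae_mem_scatteringStates (hψ : IsBetheKernel ψ) :
    ∀ᵐ z : Phase N, z ∈ scatteringStates ψ N := by
  have := isAddHaarMeasure_volume_phase N
  obtain ⟨g, hg, hg1, hg2⟩ := hψ.exists_contDiff_inverse_source (N := N)
  have h0 := ae_iff.1 (ae_mem_distinctMomenta (N := N))
  have h1 := addHaar_image_eq_zero_of_differentiableOn_of_addHaar_eq_zero volume
    (f := fun q => betheTarget ψ (g q))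
    ((hψ.contDiff_betheTarget.comp hg).differentiable one_ne_zero).differentiableOn h0
  rw [ae_iff]
  refine measure_mono_null (fun z hz => ?_) h1
  refine ⟨betheSource ψ (betheLift ψ z), fun hq => hz fun i j hij => ?_, ?_⟩
  · exact by_contra fun hne => hq i j hne hij
  · simp only [hg2, hψ.target_betheLift]

theorem isAsymptoticMomenta (hψ : IsBetheKernel ψ) (hr : ∀ x θ, ε ≤ |x| → dX ψ x θ = 0)
    {z : Phase N} (hz : z ∈ scatteringStates ψ N) :
    IsAsymptoticMomenta (betheHamiltonian ψ N) z (betheMomenta ψ z) := by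
  refine ⟨hψ.exists_trajectory z, ?_⟩
  rintro γ hγ rfl i
  exact ⟨hψ.tendsto_momentum hr hγ hz (Or.inr rfl) (by simpa using tendsto_neg_atBot_atTop) i,
    hψ.tendsto_momentum hr hγ hz (Or.inl rfl) (by simp only [one_mul]; exact tendsto_id) i⟩

/-- Impact parameters are y translated by a function of θ alone, so bijectivity reduces to that of
the two halves of the Bethe relation. -/
theorem bijOn_impact (hψ : IsBetheKernel ψ) (ε e : ℝ) :
    BijOn (fun z => (impact ψ ε e z, betheMomenta ψ z)) (scatteringStates ψ N)
      (distinctMomenta N) := by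
  refine ⟨fun z hz i j hij h => hij (hz h), fun z _ z' _ h => ?_, fun q hq => ?_⟩
  · have h2 : betheMomenta ψ z = betheMomenta ψ z' := (Prod.ext_iff.1 h).2
    have h1 : betheSource ψ (betheLift ψ z) = betheSource ψ (betheLift ψ z') := by
      refine Prod.ext (funext fun i => ?_) h2
      have h3 : impact ψ ε e z i = impact ψ ε e z' i := congrFun (Prod.ext_iff.1 h).1 i
      simpa only [impact, h2, sub_left_inj] using h3
    rw [← hψ.target_betheLift z, hψ.bijective_betheSource.injective h1, hψ.target_betheLift]
  · obtain ⟨u, hu⟩ := hψ.bijective_betheSource.surjective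
      ((fun i => q.1 i + ∑ j, dTheta ψ (e * Real.sign (q.2 i - q.2 j) * ε) (q.2 i - q.2 j), q.2) :
        Phase N)
    have hθ : betheMomenta ψ (betheTarget ψ u) = q.2 := by
      rw [hψ.betheMomenta_target]; exact (Prod.ext_iff.1 hu).2
    refine ⟨betheTarget ψ u, fun i j hij => ?_, Prod.ext (funext fun i => ?_) hθ⟩
    · rw [hθ] at hij
      exact by_contra fun hne => hq i j hne hij
    · simp only [impact, hθ, hψ.betheLift_target, hu, add_sub_cancel_right]

theorem isElasticFactorised (hψ : IsBetheKernel ψ) (hr : ∀ x θ, ε ≤ |x| → dX ψ x θ = 0) :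
    IsElasticFactorised (betheHamiltonian ψ N)
      (fun a b => dTheta ψ ε (a - b) - dTheta ψ (-ε) (a - b)) (scatteringStates ψ N)
      (betheMomenta ψ) (impact ψ ε (-1)) (impact ψ ε 1) (fun _ => 1) where
  dense := dense_of_ae_phase hψ.ae_mem_scatteringStates
  invariant γ hγ h0 t := by
    change Function.Injective (betheMomenta ψ (γ t))
    rw [hψ.betheMomenta_trajectory hγ t]
    exact h0
  in_p γ hγ h0 i := ((hψ.isAsymptoticMomenta hr h0).2 γ hγ rfl i).1
  in_x γ hγ h0 i := hψ.tendsto_position hr hγ h0 (Or.inr rfl)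
    (by simpa using tendsto_neg_atBot_atTop) i
  out_p γ hγ h0 i := ((hψ.isAsymptoticMomenta hr h0).2 γ hγ rfl i).2
  out_x γ hγ h0 i := hψ.tendsto_position hr hγ h0 (Or.inl rfl) (by simp only [one_mul]; exact tendsto_id) i
  shift z _ i := by
    rw [Finset.sum_erase _ (by simp)]
    simp only [impact, sub_sub_sub_cancel_left, ← Finset.sum_sub_distrib]
    refine Finset.sum_congr rfl fun j _ => ?_
    rw [← neg_sub (betheMomenta ψ z i), Real.sign_neg]
    -- With σ the sign of θ_i - θ_j, each pair contributes ψ_θ(-σε, ·) - ψ_θ(σε, ·), which is -σ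
    -- times the two-body shift.
    rcases Real.sign_apply_eq (betheMomenta ψ z i - betheMomenta ψ z j) with h | h | h <;>
      rw [h] <;> simp
  bij := hψ.bijOn_impact ε (-1)

theorem isFiniteRangeTracer (hψ : IsBetheKernel ψ) (hr : ∀ x θ, ε ≤ |x| → dX ψ x θ = 0) :
    IsFiniteRangeTracer ε (fun a b => dTheta ψ ε (a - b) - dTheta ψ (-ε) (a - b))
      (betheHamiltonian ψ) (scatteringStates ψ) (fun _ => betheMomenta ψ) := by
  have h : ∀ c, ContDiff ℝ 1 fun q : ℝ × ℝ => dTheta ψ c (q.1 - q.2) := fun c =>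
    hψ.contDiff_dTheta.comp (contDiff_const.prodMk (contDiff_fst.sub contDiff_snd))
  refine ⟨(h ε).sub (h (-ε)), fun N _ => ⟨_, _, _, hψ.isElasticFactorised hr, fun _ _ => rfl⟩,
    fun n r z => betheMomenta ψ z r, fun n r => contDiff_pi.1 hψ.contDiff_betheMomenta r,
    fun N _ z I hI r => (hψ.betheMomenta_restrictTo hr z hI r).symm⟩

theorem isGenTTbarFlow (hψ : IsBetheKernel ψ) (hε : 0 < ε)
    (hr : ∀ x θ, ε ≤ |x| → dX ψ x θ = 0) :
    IsGenTTbarFlow (fun x θ => dX ψ x θ / 2) fun s => betheHamiltonian (_root_.scaled s ψ) where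
  contDiff := hψ.contDiff_dX.div_const 2
  system s hs := (hψ.scaled hs.1).isManyBodySystem
  differentiable s hs N _ z := ((hψ.hasDerivWithinAt_betheHamiltonian hs.1 z).mono
    Icc_subset_Ici_self).differentiableWithinAt
  flow s hs := by
    have hrs : ∀ x θ, ε ≤ |x| → dX (_root_.scaled s ψ) x θ = 0 := fun x θ hx => by
      rw [dX_scaled, hr x θ hx, mul_zero]
    exact ⟨ε, hε, (hψ.scaled hs.1).isFiniteRangeLiouville hrs, _, _, _,
      (hψ.scaled hs.1).isFiniteRangeTracer hrs, fun N _ z _ =>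
        (hψ.hasDerivWithinAt_betheHamiltonian hs.1 z).mono Icc_subset_Ici_self⟩

end IsBetheKernel

/-! ### The main theorem -/

theorem theorem2p2 (ψ : ℝ → ℝ → ℝ) (ε : ℝ) (hε : 0 < ε)
    (hψ : ContDiff ℝ 2 (Function.uncurry ψ))
    (hmono : ∀ x θ, 0 ≤ dTheta (dX ψ) x θ)
    (hsymm : ∀ x θ, ψ (-x) (-θ) = ψ x θ)
    (hrange : ∀ x θ, ε ≤ |x| → dX ψ x θ = 0) :
    -- the map `ω` of the system `s ψ` is a bijection, so `θ^s` and `H_{sψ}` are well defined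
    (∀ s : ℝ, 0 ≤ s → ∀ N : ℕ,
      (∀ q : Phase N, ∃! z : Phase N, BetheRel (scaled s ψ) q z) ∧
      (∀ z : Phase N, ∃! q : Phase N, BetheRel (scaled s ψ) q z)) ∧
    -- `H_{sψ}` is differentiable in `s` and satisfies the flow equation, at every phase-space point
    (∀ s : ℝ, 0 ≤ s → ∀ (N : ℕ) (z : Phase N),
      HasDerivWithinAt (fun u : ℝ => betheHamiltonian (scaled u ψ) N z)
        (ttbarSource (fun x θ => dX ψ x θ / 2) (betheHamiltonian (scaled s ψ) N) z
          (betheMomenta (scaled s ψ) z))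
        (Ici 0) s) ∧
    -- almost everywhere, `θ^s` are the asymptotic momenta of the dynamics generated by `H_{sψ}`
    (∀ s : ℝ, 0 ≤ s → ∀ N : ℕ, ∀ᵐ z : Phase N,
      IsAsymptoticMomenta (betheHamiltonian (scaled s ψ) N) z (betheMomenta (scaled s ψ) z)) ∧
    -- the family is a generalised `TT̄` flow, with deformation function `ψ_x / 2`
    IsGenTTbarFlow (fun x θ => dX ψ x θ / 2) (fun s => betheHamiltonian (scaled s ψ)) ∧
    -- hence `H_ψ` is a generalised `TT̄`-deformation of the free particles
    IsGenTTbarDeformation freeHamiltonian (betheHamiltonian ψ) := by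
  have hk : IsBetheKernel ψ := ⟨hψ, hmono, hsymm⟩
  have hflow := hk.isGenTTbarFlow hε hrange
  refine ⟨fun s hs N => ⟨(hk.scaled hs).existsUnique_target, (hk.scaled hs).existsUnique_source⟩,
    fun s hs N z => hk.hasDerivWithinAt_betheHamiltonian hs z, fun s hs N => ?_, hflow,
    _, _, ?_, ?_, hflow⟩
  · filter_upwards [(hk.scaled hs).ae_mem_scatteringStates] with z hz
    exact (hk.scaled hs).isAsymptoticMomenta
      (fun x θ hx => by rw [dX_scaled, hrange x θ hx, mul_zero]) hz
  · funext N z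
    simp only [betheHamiltonian, freeHamiltonian, hk.betheMomenta_scaled_zero]
  · have h : scaled 1 ψ = ψ := by funext x θ; simp [scaled]
    simp only [h]
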